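/- Let $L$ be an algebraically closed field that is complete with respect to a non-archimedean absolute value $|\cdot|$, let $\phi\in L[z]$ be a polynomial of degree $d\ge 2$, let $F=\{z\in L : |\phi^n(z)|\not\to\infty\}$ be its filled Julia set, and assume that $F$ is compact. Let $\hat h_\phi(z)=\lim_{n\to\infty} d^{-n}\log^+|\phi^n(z)|$ be the canonical local height on $L$. For a bounded set $A\subseteq L$ let $$c(A)=\lim_{n\to\infty}\ \sup_{x_1,\dots,x_n\in A}\ \prod_{i\ne j}|x_i-x_j|^{\frac1{n(n-1)}}$$ be its transfinite diameter. A sequence $(S_n)$ of finite subsets of $L$ is called - *$\hat h_\phi$-taut* if $\frac1{\#S_n}\sum_{z\in S_n}\hat h_\phi(z)\to 0$; - *$F$-tight* if for all $\delta,\epsilon>0$ and all sufficiently large $n$, at least $(1-\epsilon)\,\#S_n$ elements of $S_n$ lie at distance at most $\delta$ from $F$; - *pseudo-equidistributed with respect to $(F,\hat h_\phi)$* if it is $\hat h_\phi$-taut, $N_n:=\#S_n\to\infty$, and $\prod_{x,y\in S_n,\,x\ne y}|x-y|^{\frac1{N_n(N_n-1)}}\to c(F)$; - *equidistributed with respect to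 a Borel measure $\mu$ on $L$* if $\frac1{\#S_n}\sum_{z\in S_n}f(z)\to\int f\,d\mu$ for every bounded continuous function $f:L\to\mathbb R$. Then: 1. every $\hat h_\phi$-taut sequence of finite subsets of $L$ is $F$-tight; 2. there is a unique equilibrium measure $\mu_F$ of $F$, that is, a unique Borel probability measure supported on $F$ which minimizes the energy $\iint -\log|x-y|\,d\mu(x)\,d\mu(y)\in(-\infty,+\infty]$ among all Borel probability measures $\mu$ supported on $F$; 3. every sequence of finite subsets of $L$ that is pseudo-equidistributed with respect to $(F,\hat h_\phi)$ is equidistributed with respect to $\mu_F$. -/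

import Mathlib

open Filter Topology MeasureTheory
open scoped ENNReal BoundedContinuousFunction

namespace NonarchEquidist

noncomputable section

section Dynamics

variable {L : Type*} [NormedField L]

/-- The filled Julia set of a polynomial: the points whose orbit does not tend to infinity. -/
def filledJuliaSet (φ : Polynomial L) : Set L :=
  {z | ¬ Tendsto (fun n : ℕ => ‖(fun w => φ.eval w)^[n] z‖) atTop atTop}

/-- The canonical local height `z ↦ lim d⁻ⁿ log⁺ |φⁿ(z)|`, with `d` the degree of `φ`.
(For `d ≥ 2` the limit exists at every point.) -/
def canonicalLocalHeight (φ : Polynomial L) (z : L) : ℝ :=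
  limUnder atTop fun n : ℕ =>
    (1 / (φ.natDegree : ℝ) ^ n) * Real.posLog ‖(fun w => φ.eval w)^[n] z‖

end Dynamics

section Metric

variable {M : Type*} [MetricSpace M]

/-- The `n`-th diameter of a bounded set: the supremum over its `n`-tuples of the geometric mean
of the pairwise distances (over ordered pairs of distinct indices). -/
def nthDiameter (A : Set M) (n : ℕ) : ℝ :=
  ⨆ x : Fin n → A, ∏ p ∈ (Finset.univ : Finset (Fin n)).offDiag,
    dist (x p.1 : M) (x p.2 : M) ^ (1 / ((n : ℝ) * ((n : ℝ) - 1)))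

/-- The transfinite diameter of a bounded set. The sequence of `n`-th diameters decreases
from `n = 2` on, so the limit exists. -/
def transfiniteDiameter (A : Set M) : ℝ :=
  limUnder atTop (nthDiameter A)

open Classical in
/-- The geometric mean of the distances between distinct points of a finite set. -/
def meanDistance (S : Finset M) : ℝ :=
  ∏ p ∈ S.offDiag, dist p.1 p.2 ^ (1 / ((S.card : ℝ) * ((S.card : ℝ) - 1)))

/-- The average value of `lam` on `S n` tends to zero. -/
def IsTaut (lam : M → ℝ) (S : ℕ → Finset M) : Prop :=
  Tendsto (fun n => (1 / ((S n).card : ℝ)) * ∑ z ∈ S n, lam z) atTop (𝓝 0)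

/-- Generalized Fekete sequences for `F`. -/
def IsGeneralizedFekete (F : Set M) (S : ℕ → Finset M) : Prop :=
  Tendsto (fun n => (S n).card) atTop atTop ∧
    Tendsto (fun n => meanDistance (S n)) atTop (𝓝 (transfiniteDiameter F))

/-- Pseudo-equidistribution with respect to the pair `(F, lam)`. -/
def IsPseudoEquidistributed (F : Set M) (lam : M → ℝ) (S : ℕ → Finset M) : Prop :=
  IsTaut lam S ∧ IsGeneralizedFekete F S

open Classical in
/-- `F`-tightness: for all `δ, ε > 0`, eventually at least `(1 - ε) #(S n)` elements of `S n` lie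
at distance at most `δ` from `F`. -/
def IsTight (F : Set M) (S : ℕ → Finset M) : Prop :=
  ∀ δ > (0 : ℝ), ∀ ε > (0 : ℝ), ∃ N : ℕ, ∀ n ≥ N,
    (1 - ε) * ((S n).card : ℝ) ≤ (((S n).filter (· ∈ Metric.cthickening δ F)).card : ℝ)

variable [MeasurableSpace M]

/-- The uniform probability measure on a nonempty finite set. -/
def uniformMeasure (S : Finset M) : Measure M :=
  (S.card : ℝ≥0∞)⁻¹ • ∑ z ∈ S, Measure.dirac z

/-- Weak convergence of measures: convergence of integrals of bounded continuous functions. -/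
def ConvergesWeakly (μs : ℕ → Measure M) (μ : Measure M) : Prop :=
  ∀ f : M →ᵇ ℝ, Tendsto (fun n => ∫ x, f x ∂(μs n)) atTop (𝓝 (∫ x, f x ∂μ))

/-- The uniform measures on the `S n` converge weakly to `μ`. -/
def IsEquidistributed (S : ℕ → Finset M) (μ : Measure M) : Prop :=
  ConvergesWeakly (fun n => uniformMeasure (S n)) μ

/-- The kernel `-log d(x, y)`, equal to `+∞` on the diagonal. -/
def logKernel (x y : M) : EReal :=
  -ENNReal.log (edist x y)

/-- The energy `∬ -log d(x, y) dμ(x) dμ(y)` of a measure with bounded support, as an extended real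
number: the integral of the positive part of the kernel, possibly `+∞`, minus the integral of
its negative part, which is finite. -/
def energy (μ : Measure M) : EReal :=
  ((∫⁻ x, ∫⁻ y, (logKernel x y).toENNReal ∂μ ∂μ : ℝ≥0∞) : EReal) -
    ((∫⁻ x, ∫⁻ y, (-logKernel x y).toENNReal ∂μ ∂μ : ℝ≥0∞) : EReal)

/-- `μ` has minimal energy among the probability measures supported on `F`. -/
structure IsEquilibriumMeasure (F : Set M) (μ : Measure M) : Prop where
  isProbabilityMeasure : IsProbabilityMeasure μ
  supported : μ Fᶜ = 0
  energy_le : ∀ ν : Measure M, IsProbabilityMeasure ν → ν Fᶜ = 0 → energy μ ≤ energy ν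

end Metric

end

end NonarchEquidist

namespace NonarchEquidist

/-! Write `h` for the canonical height and `I(ρ, σ) = ∬ -log |x - y|`. The proof rests on two facts.

Potential: with `V = log |a| / (d - 1)`, `a` the leading coefficient of `φ`, there is a probability
measure `μ` on `F` whose potential lies between `V - h` and `V` everywhere
(`exists_measure_integral_truncLog`). It is a weak limit of the uniform measures on the roots of
`φ^n - b`, `b` a fixed point; their potentials are `d⁻ⁿ (log |aₙ| - log |φ^n(x) - b|)`, `aₙ` the
leading coefficient of `φ^n`, which gives the lower bound. The upper bound holds because a compact
`F` contains no disc: near every `x` some point escapes, and there `|φ^n - b| ≥ 1` eventually.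

Positivity: on an ultrametric space "distance at most `r`" is an equivalence relation, so decreasing
functions of the distance are positive semidefinite kernels. Hence `I(ν - μ, ν - μ) ≥ 0`, and by
Cauchy–Schwarz this energy bounds the difference of the integrals of `truncLog r₀ x - truncLog r₁ x`
against `ν` and `μ` (`sq_integral_truncLog_sub_le`). These functions detect weak convergence to `μ`,
since they nearly measure balls.

Together, `0 ≤ I(ν - μ, ν - μ) ≤ I(ν, ν) - V + 2 ∫ h dν`, up to truncation errors. For `ν` on `F`
this gives minimality of `μ`, its uniqueness, and `c(F) ≤ exp(-V)`; choosing points greedily gives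
the reverse inequality. For the uniform measure on `S n`, tautness and the Fekete condition send the
right side to zero, whence equidistribution. Truncation at `r` keeps everything finite, the diagonal
costing only `-log r / N`.

Tightness is separate: `h` is bounded below off each neighbourhood of `F`, again because `F`
contains no disc. -/

/-- The kernel `-log d(x, y)`, truncated at distance `r`. -/
noncomputable def truncLog {M : Type*} [MetricSpace M] (r : ℝ) (x y : M) : ℝ :=
  -Real.log (max (dist x y) r)

theorem truncLog_sub_nonneg {M : Type*} [MetricSpace M] {r₀ r₁ : ℝ} (h₀ : 0 < r₀)
    (h₁ : r₀ ≤ r₁) (x y : M) :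
    0 ≤ truncLog r₀ x y - truncLog r₁ x y := by
  have : Real.log (max (dist x y) r₀) ≤ Real.log (max (dist x y) r₁) :=
    Real.log_le_log (lt_max_of_lt_right h₀) (max_le_max_left _ h₁)
  simp only [truncLog]; linarith

/-! ### Positivity of truncated logarithms on finite charges -/

section FiniteEnergy

variable {M ι : Type*} [MetricSpace M] [IsUltrametricDist M] [Fintype ι]

theorem sum_mul_mul_ite_eq_nonneg {α : Type*} [DecidableEq α] (q : ι → α) (w : ι → ℝ) :
    0 ≤ ∑ i, ∑ j, w i * w j * (if q i = q j then 1 else 0) := by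
  have h : ∑ i, ∑ j, w i * w j * (if q i = q j then (1 : ℝ) else 0) =
      ∑ c ∈ Finset.univ.image q, (∑ i with q i = c, w i) ^ 2 := by
    rw [← Finset.sum_fiberwise_of_maps_to (g := q) (t := Finset.univ.image q) (by simp)]
    refine Finset.sum_congr rfl fun c _ => ?_
    rw [sq, Finset.sum_mul]
    refine Finset.sum_congr rfl fun i hi => ?_
    rw [Finset.mul_sum, Finset.sum_filter]
    refine Finset.sum_congr rfl fun j _ => ?_
    have hi' : q i = c := by simpa using hi
    rw [hi']
    by_cases h : c = q j
    · simp [h]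
    · simp [h, Ne.symm h]
  rw [h]
  exact Finset.sum_nonneg fun c _ => sq_nonneg _

/-- On an ultrametric space, antitone nonnegative functions of the distance are positive
semidefinite kernels. -/
theorem sum_antitone_dist_nonneg {g : ℝ → ℝ} (hg : AntitoneOn g (Set.Ici 0)) (hg0 : ∀ t, 0 ≤ g t)
    (p : ι → M) (w : ι → ℝ) :
    0 ≤ ∑ i, ∑ j, w i * w j * g (dist (p i) (p j)) := by
  classical
  -- Layer-cake formula: it suffices to treat, for each level `s`, the kernel that is `1` where `s <
  -- g(dist)`.
  have hrep : ∀ x y : M, g (dist x y) =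
      ∫ s, (Set.Ico 0 (g (dist x y))).indicator (fun _ => (1 : ℝ)) s := fun x y => by
    rw [integral_indicator measurableSet_Ico]
    simp [hg0]
  have hint : ∀ x y : M,
      Integrable (fun s : ℝ => (Set.Ico 0 (g (dist x y))).indicator (fun _ => (1 : ℝ)) s) := by
    intro x y
    exact (integrable_indicator_iff measurableSet_Ico).2 (integrableOn_const (by simp))
  have heq : ∑ i, ∑ j, w i * w j * g (dist (p i) (p j)) = ∫ s, ∑ i, ∑ j, w i * w j *
      (Set.Ico 0 (g (dist (p i) (p j)))).indicator (fun _ => (1 : ℝ)) s := by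
    rw [integral_finsetSum _ fun i _ => integrable_finsetSum _ fun j _ => (hint _ _).const_mul _]
    refine Finset.sum_congr rfl fun i _ => ?_
    rw [integral_finsetSum _ fun j _ => (hint _ _).const_mul _]
    refine Finset.sum_congr rfl fun j _ => ?_
    rw [integral_const_mul, ← hrep]
  rw [heq]
  refine integral_nonneg fun s => ?_
  -- For these `s` the relation `s < g(dist)` is an equivalence (`s < g 0` is reflexivity, the
  -- ultrametric inequality transitivity), so labelling points by their classes makes the form a sum
  -- of squares. For other `s` it vanishes.
  by_cases hs : 0 ≤ s ∧ s < g 0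
  · have := sum_mul_mul_ite_eq_nonneg (fun i => {y : M | s < g (dist (p i) y)}) w
    refine this.trans_eq (Finset.sum_congr rfl fun i _ => Finset.sum_congr rfl fun j _ => ?_)
    rw [Set.indicator_apply]
    congr 1
    refine if_congr ?_ rfl rfl
    simp only [Set.mem_Ico, hs.1, true_and]
    symm
    have anti : ∀ {a b c : M}, s < g (dist a b) → s < g (dist b c) → s < g (dist a c) := by
      intro a b c hab hbc
      have h := dist_triangle_max a b c
      rcases le_max_iff.1 h with h | h
      · exact hab.trans_le (hg dist_nonneg dist_nonneg h)
      · exact hbc.trans_le (hg dist_nonneg dist_nonneg h)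
    constructor
    · intro h
      ext y
      simp only [Set.mem_ofPred_eq]
      exact ⟨fun h' => anti (by rwa [dist_comm]) h', fun h' => anti h h'⟩
    · intro h
      have : p j ∈ {y : M | s < g (dist (p j) y)} := by simpa using hs.2
      rw [← h] at this
      exact this
  · have : ∀ x y : M, (Set.Ico 0 (g (dist x y))).indicator (fun _ => (1 : ℝ)) s = 0 := by
      intro x y
      refine Set.indicator_of_notMem (fun h => hs ⟨h.1, h.2.trans_le ?_⟩) _
      exact hg Set.self_mem_Ici dist_nonneg dist_nonneg
    simp [this]

/-- The kernel is the logarithm of `max t r₁ / max t r₀` at `t = dist`, a nonincreasing function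
with values at least `1`. -/
theorem sum_truncLog_sub_nonneg {r₀ r₁ : ℝ} (h₀ : 0 < r₀) (h₁ : r₀ ≤ r₁) (p : ι → M) (w : ι → ℝ) :
    0 ≤ ∑ i, ∑ j, w i * w j * (truncLog r₀ (p i) (p j) - truncLog r₁ (p i) (p j)) := by
  have := sum_antitone_dist_nonneg
    (g := fun t => Real.log (max t r₁) - Real.log (max t r₀)) ?_ ?_ p w
  · refine this.trans_eq (Finset.sum_congr rfl fun i _ => Finset.sum_congr rfl fun j _ => ?_)
    simp only [truncLog]; ring
  · intro s hs t _ hst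
    have hs : 0 ≤ s := hs
    have hm : ∀ {a b : ℝ}, 0 < b → 0 < max a b := fun h => lt_max_of_lt_right h
    have h₁' := h₀.trans_le h₁
    simp only
    rw [← Real.log_div (hm h₁').ne' (hm h₀).ne', ← Real.log_div (hm h₁').ne' (hm h₀).ne']
    refine Real.log_le_log (div_pos (hm h₁') (hm h₀)) ?_
    rw [div_le_div_iff₀ (hm h₀) (hm h₀)]
    rcases le_total t r₁ with ht | ht
    · rw [max_eq_right ht, max_eq_right (hst.trans ht)]
      exact mul_le_mul_of_nonneg_left (max_le_max_right _ hst) h₁'.le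
    · rw [max_eq_left ht, max_eq_left (h₁.trans ht), mul_comm]
      exact mul_le_mul_of_nonneg_right (max_le_max_left _ h₁) (h₀.le.trans (h₁.trans ht))
  · intro t
    have := Real.log_le_log (lt_max_of_lt_right h₀) (max_le_max_left t h₁)
    simpa using this

/-- Cauchy–Schwarz inequality for a positive semidefinite kernel obtained as a difference
of truncated logarithms. -/
theorem sq_sum_truncLog_sub_le {r₀ r₁ : ℝ} (h₀ : 0 < r₀) (h₁ : r₀ ≤ r₁) (p : ι → M) (w : ι → ℝ)
    (x : M) :
    (∑ i, w i * (truncLog r₀ x (p i) - truncLog r₁ x (p i))) ^ 2 ≤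
      (Real.log r₁ - Real.log r₀) *
        ∑ i, ∑ j, w i * w j * (truncLog r₀ (p i) (p j) - truncLog r₁ (p i) (p j)) := by
  set k : M → M → ℝ := fun y z => truncLog r₀ y z - truncLog r₁ y z with hk
  have hsymm : ∀ y z, k y z = k z y := fun y z => by simp [hk, truncLog, dist_comm]
  have hxx : k x x = Real.log r₁ - Real.log r₀ := by
    simp [hk, truncLog, h₀.le, h₀.le.trans h₁]; ring
  set b := ∑ i, w i * k x (p i) with hb
  set q := ∑ i, ∑ j, w i * w j * k (p i) (p j) with hq
  -- Adjoin `x` to the configuration with a variable weight `s`; the discriminant of the resulting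
  -- nonnegative quadratic is the claim.
  have key : ∀ s : ℝ, 0 ≤ k x x * (s * s) + 2 * b * s + q := by
    intro s
    have := sum_truncLog_sub_nonneg h₀ h₁ (ι := Option ι) (fun o => o.elim x p)
      (fun o => o.elim s w)
    simp only [Fintype.sum_option, Option.elim] at this
    refine this.trans_eq ?_
    change s * s * k x x + ∑ i, s * w i * k x (p i) +
      ∑ i, (w i * s * k (p i) x + ∑ j, w i * w j * k (p i) (p j)) = _
    rw [Finset.sum_add_distrib, ← hq]
    have e1 : ∑ i, s * w i * k x (p i) = s * b := by
      rw [hb, Finset.mul_sum]; exact Finset.sum_congr rfl fun i _ => by ring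
    have e2 : ∑ i, w i * s * k (p i) x = s * b := by
      rw [hb, Finset.mul_sum]
      exact Finset.sum_congr rfl fun i _ => by rw [hsymm]; ring
    rw [e1, e2]; ring
  have := discrim_le_zero key
  rw [discrim, hxx] at this
  change b ^ 2 ≤ _ * q
  nlinarith

/-- Beyond the diameter of the configuration the truncated kernel is constant, and total weight zero
kills it. -/
theorem sum_truncLog_nonneg {r : ℝ} (hr : 0 < r) (p : ι → M) {w : ι → ℝ} (hw : ∑ i, w i = 0) :
    0 ≤ ∑ i, ∑ j, w i * w j * truncLog r (p i) (p j) := by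
  obtain ⟨R, hR⟩ : ∃ R, ∀ i j, dist (p i) (p j) ≤ R := by
    obtain ⟨R, hR⟩ := (Set.finite_range fun a : ι × ι => dist (p a.1) (p a.2)).bddAbove
    exact ⟨R, fun i j => hR ⟨(i, j), rfl⟩⟩
  have := sum_truncLog_sub_nonneg hr (le_max_left r R) p w
  refine this.trans_eq ?_
  have hc : ∀ i j, truncLog (max r R) (p i) (p j) = -Real.log (max r R) := fun i j => by
    rw [truncLog, max_eq_right ((hR i j).trans (le_max_right _ _))]
  simp only [hc, mul_sub, Finset.sum_sub_distrib, ← Finset.sum_mul, ← Finset.mul_sum, hw]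
  simp

/-- Energy decreases as the truncation radius grows, and the energy at `r₁` is nonnegative, so the
form of the difference is at most the energy at the finest scale `r`. -/
theorem sq_sum_truncLog_sub_le_energy {r r₀ r₁ : ℝ} (hr : 0 < r) (h₀ : r ≤ r₀) (h₁ : r₀ ≤ r₁)
    (p : ι → M) {w : ι → ℝ} (hw : ∑ i, w i = 0) (x : M) :
    (∑ i, w i * (truncLog r₀ x (p i) - truncLog r₁ x (p i))) ^ 2 ≤
      (Real.log r₁ - Real.log r₀) * ∑ i, ∑ j, w i * w j * truncLog r (p i) (p j) := by
  have hr₀ := hr.trans_le h₀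
  refine (sq_sum_truncLog_sub_le hr₀ h₁ p w x).trans ?_
  refine mul_le_mul_of_nonneg_left ?_ (sub_nonneg.2 (Real.log_le_log hr₀ h₁))
  have e1 := sum_truncLog_sub_nonneg hr h₀ p w
  have e2 := sum_truncLog_nonneg (hr₀.trans_le h₁) p hw
  simp only [mul_sub, Finset.sum_sub_distrib] at e1 ⊢
  linarith

end FiniteEnergy

/-! ### Local constancy of the truncated kernel -/

section TruncLog

variable {M : Type*} [MetricSpace M]

theorem truncLog_comm (r : ℝ) (x y : M) : truncLog r x y = truncLog r y x := by
  rw [truncLog, truncLog, dist_comm]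

theorem truncLog_congr_right [IsUltrametricDist M] {r : ℝ} {y z : M} (h : dist y z ≤ r) (x : M) :
    truncLog r x y = truncLog r x z := by
  have aux : ∀ {y z : M}, dist y z ≤ r → max (dist x y) r ≤ max (dist x z) r := by
    intro y z h
    refine max_le ((dist_triangle_max x z y).trans ?_) (le_max_right _ _)
    exact max_le_max_left _ (by rwa [dist_comm])
  rw [truncLog, truncLog, le_antisymm (aux h) (aux (by rwa [dist_comm]))]

theorem truncLog_congr_left [IsUltrametricDist M] {r : ℝ} {y z : M} (h : dist y z ≤ r) (x : M) :
    truncLog r y x = truncLog r z x := by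
  rw [truncLog_comm, truncLog_congr_right h, truncLog_comm]

theorem continuous_truncLog {r : ℝ} (hr : 0 < r) (x : M) : Continuous (truncLog r x) := by
  unfold truncLog
  refine Continuous.neg (Continuous.log (by fun_prop) fun y => ?_)
  exact (lt_max_of_lt_right hr).ne'

theorem truncLog_le {r : ℝ} (hr : 0 < r) (x y : M) : truncLog r x y ≤ -Real.log r :=
  neg_le_neg (Real.log_le_log hr (le_max_right _ _))

theorem continuous_of_locally_const {α : Type*} [TopologicalSpace α] {f : M → α} {r : ℝ} (hr : 0 < r)
    (hf : ∀ y z, dist y z ≤ r → f y = f z) : Continuous f := by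
  refine continuous_iff_continuousAt.2 fun y => ?_
  refine (continuousAt_const (y := f y)).congr ?_
  filter_upwards [Metric.closedBall_mem_nhds y hr] with z hz
  exact hf y z (by rwa [dist_comm])

end TruncLog

/-! ### From finite charges to measures on a compact set -/

section Discretization

/-- The identity is exact: functions constant at scale `r` do not see the move to the centres of an
`r`-net. Finite inequalities thus transfer to measures without a limit. -/
theorem integral_eq_sum_of_discretization {M : Type*} [MetricSpace M] [MeasurableSpace M]
    {C : Set M} {r : ℝ} {m : ℕ} {c : Fin m → M}
    {π : M → Fin m} (hπ : Measurable π) (hc : ∀ y ∈ C, dist (c (π y)) y ≤ r) {ν : Measure M}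
    [IsProbabilityMeasure ν] (hν : ν Cᶜ = 0) {f : M → ℝ} (hf : ∀ y z, dist y z ≤ r → f y = f z) :
    ∫ y, f y ∂ν = ∑ i, (ν.map π).real {i} * f (c i) := by
  have hae : ∀ᵐ y ∂ν, y ∈ C := by rwa [ae_iff]
  have h1 : ∫ y, f y ∂ν = ∫ y, f (c (π y)) ∂ν :=
    integral_congr_ae (hae.mono fun y hy => (hf _ _ (hc y hy)).symm)
  rw [h1, ← integral_map (φ := π) (f := fun i => f (c i)) hπ.aemeasurable
    (measurable_of_countable _).aestronglyMeasurable]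
  have : IsProbabilityMeasure (ν.map π) := Measure.isProbabilityMeasure_map hπ.aemeasurable
  rw [integral_fintype (Integrable.of_finite)]
  simp

variable {M : Type*} [MetricSpace M] [MeasurableSpace M] [BorelSpace M]

theorem exists_discretization {C : Set M} (hC : IsCompact C) (hne : C.Nonempty) {r : ℝ}
    (hr : 0 < r) : ∃ (m : ℕ) (c : Fin m → M) (π : M → Fin m), Measurable π ∧
      ∀ y ∈ C, dist (c (π y)) y ≤ r := by
  obtain ⟨x₀, -⟩ := hne
  obtain ⟨t, -, ht, hcov⟩ := hC.finite_cover_balls hr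
  lift t to Finset M using ht
  -- `nearestPtInd e N` picks among `e 0, …, e N`; the last is the default `x₀`, a harmless extra
  -- candidate.
  set e : ℕ → M := fun n => t.toList.getD n x₀ with he
  set N := t.toList.length
  refine ⟨N + 1, fun i => e i,
    fun y => ⟨SimpleFunc.nearestPtInd e N y, Nat.lt_succ_of_le (SimpleFunc.nearestPtInd_le e N y)⟩,
    measurable_to_countable' fun i => ?_, fun y hy => ?_⟩
  · have := (SimpleFunc.nearestPtInd e N).measurableSet_fiber i
    convert this using 1
    ext y
    simp [Fin.ext_iff]
  · obtain ⟨c, hc, hyc⟩ := Set.mem_iUnion₂.1 (hcov hy)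
    obtain ⟨k, hk, hkc⟩ := List.getElem_of_mem (Finset.mem_toList.2 (Finset.mem_coe.1 hc))
    have h1 := SimpleFunc.edist_nearestPt_le e y (N := N) hk.le
    have h2 : e k = c := by simp only [he, List.getD_eq_getElem _ _ hk, hkc]
    rw [h2] at h1
    have h3 : edist c y ≤ ENNReal.ofReal r := by
      rw [edist_comm, edist_dist]
      exact ENNReal.ofReal_le_ofReal (Metric.mem_ball.1 hyc).le
    have := h1.trans h3
    rw [edist_dist, ENNReal.ofReal_le_ofReal_iff hr.le] at this
    exact this

variable [IsUltrametricDist M]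

/-- The finite Cauchy–Schwarz bound for `ν - μ`, both measures being moved to the same `r`-net. -/
theorem sq_integral_truncLog_sub_le {C : Set M} (hC : IsCompact C) {μ ν : Measure M}
    [IsProbabilityMeasure μ] [IsProbabilityMeasure ν] (hμ : μ Cᶜ = 0) (hν : ν Cᶜ = 0)
    {r r₀ r₁ : ℝ} (hr : 0 < r) (h₀ : r ≤ r₀) (h₁ : r₀ ≤ r₁) (x : M) :
    (∫ y, (truncLog r₀ x y - truncLog r₁ x y) ∂ν - ∫ y, (truncLog r₀ x y - truncLog r₁ x y) ∂μ) ^ 2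
      ≤ (Real.log r₁ - Real.log r₀) * (∫ x, ∫ y, truncLog r x y ∂ν ∂ν
        - 2 * ∫ x, ∫ y, truncLog r x y ∂μ ∂ν + ∫ x, ∫ y, truncLog r x y ∂μ ∂μ) := by
  have hne : C.Nonempty := by
    by_contra h
    rw [Set.not_nonempty_iff_eq_empty] at h
    simp [h] at hμ
  obtain ⟨m, c, π, hπ, hc⟩ := exists_discretization hC hne hr
  have hk : ∀ y z, dist y z ≤ r →
      truncLog r₀ x y - truncLog r₁ x y = truncLog r₀ x z - truncLog r₁ x z := fun y z h => by
    rw [truncLog_congr_right (h.trans h₀), truncLog_congr_right (h.trans (h₀.trans h₁))]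
  have hK : ∀ ρ : Measure M, ∀ y z, dist y z ≤ r →
      ∫ v, truncLog r y v ∂ρ = ∫ v, truncLog r z v ∂ρ := fun ρ y z h => by
    simp only [truncLog_congr_left h]
  have hK' : ∀ u y z : M, dist y z ≤ r → truncLog r u y = truncLog r u z :=
    fun u y z h => truncLog_congr_right h u
  have hsum : ∀ ρ : Measure M, IsProbabilityMeasure ρ → ρ Cᶜ = 0 →
      ∑ i, (ρ.map π).real {i} = 1 := fun ρ _ hρ => by
    have := integral_eq_sum_of_discretization hπ hc hρ (f := fun _ => 1) (fun _ _ _ => rfl)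
    simpa using this.symm
  have hE : ∀ ρ σ : Measure M, IsProbabilityMeasure ρ → IsProbabilityMeasure σ → ρ Cᶜ = 0 →
      σ Cᶜ = 0 → ∫ x, ∫ y, truncLog r x y ∂ρ ∂σ =
        ∑ i, ∑ j, (σ.map π).real {i} * (ρ.map π).real {j} * truncLog r (c i) (c j) := by
    intro ρ σ _ _ hρ hσ
    rw [integral_eq_sum_of_discretization hπ hc hσ (hK ρ)]
    refine Finset.sum_congr rfl fun i _ => ?_
    rw [integral_eq_sum_of_discretization hπ hc hρ (hK' _), Finset.mul_sum]
    exact Finset.sum_congr rfl fun j _ => by ring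
  have key := sq_sum_truncLog_sub_le_energy hr h₀ h₁ c
    (w := fun i => (ν.map π).real {i} - (μ.map π).real {i})
    (by rw [Finset.sum_sub_distrib, hsum ν ‹_› hν, hsum μ ‹_› hμ, sub_self]) x
  rw [hE ν ν ‹_› ‹_› hν hν, hE μ ν ‹_› ‹_› hμ hν, hE μ μ ‹_› ‹_› hμ hμ,
    integral_eq_sum_of_discretization hπ hc hν hk, integral_eq_sum_of_discretization hπ hc hμ hk,
    ← Finset.sum_sub_distrib]
  simp only [← sub_mul]
  refine key.trans_eq ?_
  congr 1
  have hsymm : ∑ i, ∑ j, (μ.map π).real {i} * (ν.map π).real {j} * truncLog r (c i) (c j) =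
      ∑ i, ∑ j, (ν.map π).real {i} * (μ.map π).real {j} * truncLog r (c i) (c j) := by
    rw [Finset.sum_comm]
    refine Finset.sum_congr rfl fun i _ => Finset.sum_congr rfl fun j _ => ?_
    rw [truncLog_comm]; ring
  rw [two_mul]
  nth_rewrite 2 [← hsymm]
  simp only [← Finset.sum_sub_distrib, ← Finset.sum_add_distrib]
  exact Finset.sum_congr rfl fun i _ => Finset.sum_congr rfl fun j _ => by ring

end Discretization

/-! ### Truncated logarithms as test functions for weak convergence -/

section WeakConvergence

/-- With the companion lower bound, the difference is squeezed between `log (r₁ / r₀)` times the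
indicators of two concentric balls, so its integral nearly measures a ball when `μ` has little mass
in between. -/
theorem truncLog_sub_le {M : Type*} [MetricSpace M] {r₀ r₁ : ℝ} (h₀ : 0 < r₀)
    (h₁ : r₀ ≤ r₁) (x y : M) :
    truncLog r₀ x y - truncLog r₁ x y ≤
      (Metric.ball x r₁).indicator (fun _ => Real.log r₁ - Real.log r₀) y := by
  by_cases hy : y ∈ Metric.ball x r₁
  · rw [Set.indicator_of_mem hy, truncLog, truncLog]
    rw [Metric.mem_ball, dist_comm] at hy
    rw [max_eq_right hy.le]
    have := Real.log_le_log h₀ (le_max_right (dist x y) r₀)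
    linarith
  · rw [Set.indicator_of_notMem hy, truncLog, truncLog]
    rw [Metric.mem_ball, dist_comm, not_lt] at hy
    rw [max_eq_left hy, max_eq_left (h₁.trans hy), sub_self]

theorem le_truncLog_sub {M : Type*} [MetricSpace M] {r₀ r₁ : ℝ} (h₀ : 0 < r₀)
    (h₁ : r₀ ≤ r₁) (x y : M) :
    (Metric.closedBall x r₀).indicator (fun _ => Real.log r₁ - Real.log r₀) y ≤
      truncLog r₀ x y - truncLog r₁ x y := by
  by_cases hy : y ∈ Metric.closedBall x r₀
  · rw [Set.indicator_of_mem hy, truncLog, truncLog]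
    rw [Metric.mem_closedBall, dist_comm] at hy
    rw [max_eq_right hy, max_eq_right (hy.trans h₁)]
    linarith
  · rw [Set.indicator_of_notMem hy]
    exact truncLog_sub_nonneg h₀ h₁ x y

theorem exists_closedBall_measureReal_lt {M : Type*} [MetricSpace M] [MeasurableSpace M]
    (μ : Measure M) [IsProbabilityMeasure μ] (x : M) {r : ℝ}
    (hr : 0 < r) {ε : ℝ} (hε : 0 < ε) :
    ∃ r₀, 0 < r₀ ∧ r₀ < r ∧ μ.real (Metric.ball x r) - ε < μ.real (Metric.closedBall x r₀) := by
  obtain ⟨u, hu, hur, hlim⟩ := exists_seq_strictMono_tendsto' hr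
  have hball : Metric.ball x r = ⋃ n, Metric.closedBall x (u n) := by
    ext y
    simp only [Metric.mem_ball, Set.mem_iUnion, Metric.mem_closedBall]
    constructor
    · intro h
      obtain ⟨n, hn⟩ := (hlim.eventually_const_lt h).exists
      exact ⟨n, hn.le⟩
    · rintro ⟨n, hn⟩
      exact hn.trans_lt (hur n).2
  have ht : Tendsto (fun n => μ.real (Metric.closedBall x (u n))) atTop
      (𝓝 (μ.real (Metric.ball x r))) := by
    rw [hball]
    refine (ENNReal.tendsto_toReal (measure_ne_top _ _)).comp (tendsto_measure_iUnion_atTop ?_)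
    exact fun i j hij => Metric.closedBall_subset_closedBall (hu.monotone hij)
  obtain ⟨n, hn⟩ := (ht.eventually_const_lt (sub_lt_self _ hε)).exists
  exact ⟨u n, (hur n).1, (hur n).2, hn⟩

variable {M : Type*} [MetricSpace M] [MeasurableSpace M] [BorelSpace M]

theorem integrable_truncLog_sub {r₀ r₁ : ℝ} (h₀ : 0 < r₀) (h₁ : r₀ ≤ r₁) (x : M) (μ : Measure M)
    [IsProbabilityMeasure μ] : Integrable (fun y => truncLog r₀ x y - truncLog r₁ x y) μ := by
  refine Integrable.of_bound (C := Real.log r₁ - Real.log r₀)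
    (((continuous_truncLog h₀ x).sub
      (continuous_truncLog (h₀.trans_le h₁) x)).aestronglyMeasurable) (ae_of_all _ fun y => ?_)
  rw [Real.norm_of_nonneg (truncLog_sub_nonneg h₀ h₁ x y)]
  refine (truncLog_sub_le h₀ h₁ x y).trans ?_
  exact Set.indicator_le_self' (fun _ _ => sub_nonneg.2 (Real.log_le_log h₀ h₁)) y

variable {μ : Measure M} [IsProbabilityMeasure μ] {ν : ℕ → Measure M}
  [∀ n, IsProbabilityMeasure (ν n)]

theorem eventually_measureReal_ball_le
    (h : ∀ x r₀ r₁, 0 < r₀ → r₀ < r₁ → Tendsto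
      (fun n => ∫ y, (truncLog r₀ x y - truncLog r₁ x y) ∂(ν n)) atTop
      (𝓝 (∫ y, (truncLog r₀ x y - truncLog r₁ x y) ∂μ)))
    (x : M) {r : ℝ} (hr : 0 < r) {ε : ℝ} (hε : 0 < ε) :
    ∀ᶠ n in atTop, μ.real (Metric.ball x r) - ε ≤ (ν n).real (Metric.ball x r) := by
  obtain ⟨r₀, h₀, h₁, hlt⟩ := exists_closedBall_measureReal_lt μ x hr (half_pos hε)
  have hL : 0 < Real.log r - Real.log r₀ := sub_pos.2 (Real.log_lt_log h₀ h₁)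
  have hlow : (Real.log r - Real.log r₀) * μ.real (Metric.closedBall x r₀) ≤
      ∫ y, (truncLog r₀ x y - truncLog r x y) ∂μ := by
    have := integral_mono (μ := μ) ((integrable_const _).indicator
      Metric.isClosed_closedBall.measurableSet) (integrable_truncLog_sub h₀ h₁.le x μ)
      (le_truncLog_sub h₀ h₁.le x)
    rw [integral_indicator_const _ Metric.isClosed_closedBall.measurableSet] at this
    rwa [mul_comm]
  -- After division by `log (r / r₀)` this tolerance costs `ε / 2`; the other half was spent on
  -- shrinking to the closed ball.
  filter_upwards [(h x r₀ r h₀ h₁).eventually_const_lt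
    (sub_lt_self _ (mul_pos hL (half_pos hε)))] with n hn
  have hup : ∫ y, (truncLog r₀ x y - truncLog r x y) ∂(ν n) ≤
      (Real.log r - Real.log r₀) * (ν n).real (Metric.ball x r) := by
    have := integral_mono (μ := ν n) (integrable_truncLog_sub h₀ h₁.le x (ν n))
      ((integrable_const _).indicator Metric.isOpen_ball.measurableSet)
      (truncLog_sub_le h₀ h₁.le x)
    rw [integral_indicator_const _ Metric.isOpen_ball.measurableSet] at this
    rwa [mul_comm]
  have := hlow.trans_lt (sub_lt_iff_lt_add.1 (hn.trans_le hup))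
  rw [← mul_add] at this
  have := lt_of_mul_lt_mul_left this hL.le
  linarith

variable [IsUltrametricDist M]

/-- Ultrametric balls of equal radius coincide or are disjoint. A finite cover by balls, taken as a
set of sets to discard repetitions, is therefore a disjoint family and the ballwise bounds add up.
-/
theorem eventually_measureReal_open_le {C : Set M} (hC : IsCompact C) (hμ : μ Cᶜ = 0)
    (h : ∀ x r₀ r₁, 0 < r₀ → r₀ < r₁ → Tendsto
      (fun n => ∫ y, (truncLog r₀ x y - truncLog r₁ x y) ∂(ν n)) atTop
      (𝓝 (∫ y, (truncLog r₀ x y - truncLog r₁ x y) ∂μ)))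
    {G : Set M} (hG : IsOpen G) {ε : ℝ} (hε : 0 < ε) :
    ∀ᶠ n in atTop, μ.real G - ε ≤ (ν n).real G := by
  classical
  obtain ⟨A, hAG, hA, hAμ⟩ := hG.measurableSet.exists_isClosed_lt_add (measure_ne_top μ G)
    (ENNReal.ofReal_pos.2 (half_pos hε)).ne'
  have hAC : IsCompact (A ∩ C) := hC.inter_left hA
  have hAC' : μ (A ∩ C) = μ A := measure_inter_conull hμ
  obtain ⟨δ, hδ, hsub⟩ := hAC.exists_thickening_subset_open hG (Set.inter_subset_left.trans hAG)
  obtain ⟨t, htA, ht, hcov⟩ := hAC.finite_cover_balls hδ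
  lift t to Finset M using ht
  set B : Finset (Set M) := t.image fun y => Metric.ball y δ with hB
  have hdisj : (B : Set (Set M)).PairwiseDisjoint id := by
    intro U hU V hV hUV
    obtain ⟨u, -, rfl⟩ := Finset.mem_image.1 (Finset.mem_coe.1 hU)
    obtain ⟨v, -, rfl⟩ := Finset.mem_image.1 (Finset.mem_coe.1 hV)
    rcases IsUltrametricDist.ball_eq_or_disjoint u v δ with h | h
    · exact absurd h hUV
    · exact h
  have hmeas : ∀ U ∈ B, MeasurableSet U := by
    intro U hU
    obtain ⟨u, -, rfl⟩ := Finset.mem_image.1 hU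
    exact Metric.isOpen_ball.measurableSet
  have hev : ∀ᶠ n in atTop, ∀ U ∈ B, μ.real U - ε / 2 / (B.card + 1) ≤ (ν n).real U := by
    rw [Filter.eventually_all_finset]
    intro U hU
    obtain ⟨u, -, rfl⟩ := Finset.mem_image.1 hU
    exact eventually_measureReal_ball_le h u hδ (by positivity)
  filter_upwards [hev] with n hn
  have hUG : (⋃ U ∈ B, id U) ⊆ G := by
    refine Set.iUnion₂_subset fun U hU => ?_
    obtain ⟨u, hu, rfl⟩ := Finset.mem_image.1 hU
    exact (Metric.ball_subset_thickening (htA hu) δ).trans hsub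
  have h1 : μ.real G ≤ μ.real (A ∩ C) + ε / 2 := by
    have := hAμ.le
    rw [← hAC'] at this
    have := ENNReal.toReal_mono (by simp) this
    rwa [ENNReal.toReal_add (measure_ne_top _ _) ENNReal.ofReal_ne_top,
      ENNReal.toReal_ofReal (half_pos hε).le] at this
  have h2 : μ.real (A ∩ C) ≤ ∑ U ∈ B, μ.real U := by
    refine (measureReal_mono (s₂ := ⋃ U ∈ B, id U) ?_ (measure_ne_top _ _)).trans
      (measureReal_biUnion_finset_le _ _)
    intro y hy
    obtain ⟨c, hc, hyc⟩ := Set.mem_iUnion₂.1 (hcov hy)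
    exact Set.mem_iUnion₂.2 ⟨_, Finset.mem_image_of_mem _ hc, hyc⟩
  have h3 : ∑ U ∈ B, (ν n).real U ≤ (ν n).real G := by
    have := measureReal_biUnion_finset (μ := ν n) hdisj (fun U hU => hmeas U hU)
    simp only [id] at this
    rw [← this]
    exact measureReal_mono hUG
  have h4 : ∑ U ∈ B, μ.real U - ε / 2 ≤ ∑ U ∈ B, (ν n).real U := by
    refine le_trans ?_ (Finset.sum_le_sum hn)
    rw [Finset.sum_sub_distrib, Finset.sum_const, nsmul_eq_mul]
    have : (B.card : ℝ) * (ε / 2 / (B.card + 1)) ≤ ε / 2 := by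
      rw [mul_div_assoc', div_le_iff₀ (by positivity)]
      nlinarith
    linarith
  linarith

/-- On an ultrametric space, weak convergence to a compactly supported measure may be tested
on differences of truncated logarithms. -/
theorem tendsto_probabilityMeasure_of_truncLog {C : Set M} (hC : IsCompact C) (hμ : μ Cᶜ = 0)
    (h : ∀ x r₀ r₁, 0 < r₀ → r₀ < r₁ → Tendsto
      (fun n => ∫ y, (truncLog r₀ x y - truncLog r₁ x y) ∂(ν n)) atTop
      (𝓝 (∫ y, (truncLog r₀ x y - truncLog r₁ x y) ∂μ))) :
    Tendsto (β := ProbabilityMeasure M) (fun n => ⟨ν n, inferInstance⟩) atTop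
      (𝓝 (⟨μ, inferInstance⟩ : ProbabilityMeasure M)) := by
  refine tendsto_of_forall_isOpen_le_liminf_nat' fun G hG => ?_
  refine ENNReal.le_of_forall_pos_le_add fun ε hε _ => ?_
  rw [← tsub_le_iff_right]
  refine le_liminf_of_le (by isBoundedDefault) ?_
  filter_upwards [eventually_measureReal_open_le hC hμ h hG (NNReal.coe_pos.2 hε)] with n hn
  change μ G - ε ≤ ν n G
  rw [tsub_le_iff_right, ← ENNReal.toReal_le_toReal (measure_ne_top _ _)
    (by simp), ENNReal.toReal_add (measure_ne_top _ _) ENNReal.coe_ne_top]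
  simp only [Measure.real] at hn
  simp only [ENNReal.coe_toReal]
  linarith

end WeakConvergence

/-! ### Growth and local constancy of `log⁺ |P|` -/

section Polynomials

theorem posLog_norm_congr {L : Type*} [NormedField L] [IsUltrametricDist L] {x y : L}
    (h : ‖x - y‖ ≤ 1) : Real.posLog ‖x‖ = Real.posLog ‖y‖ := by
  have aux : ∀ {x y : L}, ‖x - y‖ ≤ 1 → max 1 ‖x‖ ≤ max 1 ‖y‖ := by
    intro x y h
    refine max_le (le_max_left _ _) ?_
    calc ‖x‖ = ‖(x - y) + y‖ := by rw [sub_add_cancel]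
      _ ≤ max ‖x - y‖ ‖y‖ := IsUltrametricDist.norm_add_le_max _ _
      _ ≤ max 1 ‖y‖ := max_le_max_right _ h
  rw [Real.posLog_eq_log_max_one (norm_nonneg _), Real.posLog_eq_log_max_one (norm_nonneg _),
    le_antisymm (aux h) (aux (by rwa [norm_sub_rev]))]

variable {L : Type*} [NormedField L]

theorem exists_norm_eval_sub_le (P : Polynomial L) {R : ℝ} (hR : 0 ≤ R) :
    ∃ M, 0 ≤ M ∧ ∀ x u : L, ‖x‖ ≤ R → ‖u‖ ≤ R → ‖P.eval u - P.eval x‖ ≤ M * ‖u - x‖ := by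
  induction P using Polynomial.induction_on with
  | C a => exact ⟨0, le_rfl, fun x u _ _ => by simp⟩
  | add p q hp hq =>
    obtain ⟨A, hA, hp⟩ := hp
    obtain ⟨B, hB, hq⟩ := hq
    refine ⟨A + B, add_nonneg hA hB, fun x u hx hu => ?_⟩
    rw [Polynomial.eval_add, Polynomial.eval_add, add_sub_add_comm, add_mul]
    exact (norm_add_le _ _).trans (add_le_add (hp x u hx hu) (hq x u hx hu))
  | monomial n a h =>
    obtain ⟨A, hA, h⟩ := h
    refine ⟨‖a‖ * R ^ n + A * R, by positivity, fun x u hx hu => ?_⟩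
    have h' := h x u hx hu
    simp only [Polynomial.eval_mul, Polynomial.eval_C, Polynomial.eval_pow, Polynomial.eval_X]
      at h' ⊢
    have e : a * u ^ (n + 1) - a * x ^ (n + 1) =
        a * u ^ n * (u - x) + (a * u ^ n - a * x ^ n) * x := by ring
    rw [e, add_mul]
    refine (norm_add_le _ _).trans (add_le_add ?_ ?_)
    · rw [norm_mul, norm_mul, norm_pow]
      gcongr
    · rw [norm_mul]
      calc _ ≤ A * ‖u - x‖ * R := by gcongr
        _ = _ := by ring

theorem norm_eval_eq_prod_roots [IsAlgClosed L] (P : Polynomial L) (z : L) :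
    ‖P.eval z‖ = ‖P.leadingCoeff‖ * (P.roots.map fun a => ‖z - a‖).prod := by
  rw [(IsAlgClosed.splits P).eval_eq_prod_roots z, norm_mul]
  congr 1
  have := Multiset.prod_hom (P.roots.map fun a => z - a) (normHom (α := L))
  rw [Multiset.map_map] at this
  exact this.symm

variable [IsUltrametricDist L] [IsAlgClosed L]

theorem exists_norm_eval_growth (P : Polynomial L) : ∃ R : ℝ, 1 ≤ R ∧
    (∀ z, R < ‖z‖ → ‖P.eval z‖ = ‖P.leadingCoeff‖ * ‖z‖ ^ P.natDegree) ∧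
    ∀ z, ‖z‖ ≤ R → ‖P.eval z‖ ≤ ‖P.leadingCoeff‖ * R ^ P.natDegree := by
  classical
  obtain ⟨R, hR⟩ := (P.roots.toFinset.finite_toSet.image fun a => ‖a‖).bddAbove
  have hroot : ∀ a ∈ P.roots, ‖a‖ ≤ max 1 R := fun a ha =>
    (hR ⟨a, by simpa using ha, rfl⟩).trans (le_max_right _ _)
  have hcard : Multiset.card P.roots = P.natDegree := IsAlgClosed.card_roots_eq_natDegree
  refine ⟨max 1 R, le_max_left _ _, fun z hz => ?_, fun z hz => ?_⟩
  · rw [norm_eval_eq_prod_roots, ← hcard]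
    congr 1
    rw [Multiset.map_congr rfl fun a ha => ?_, Multiset.map_const', Multiset.prod_replicate]
    have hlt := (hroot a ha).trans_lt hz
    rw [sub_eq_add_neg, IsUltrametricDist.norm_add_eq_max_of_norm_ne_norm
      (by rw [norm_neg]; exact hlt.ne'), norm_neg, max_eq_left hlt.le]
  · rw [norm_eval_eq_prod_roots, ← hcard]
    gcongr
    rw [← Multiset.prod_replicate, ← Multiset.map_const']
    refine Multiset.prod_map_le_prod_map₀ _ _ (fun a _ => norm_nonneg _) fun a ha => ?_
    rw [sub_eq_add_neg]
    refine (IsUltrametricDist.norm_add_le_max _ _).trans (max_le hz ?_)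
    rw [norm_neg]
    exact hroot a ha

/-- On a large ball `P` is Lipschitz, and changes of size at most `1` do not affect `log⁺`; outside
it `|P(z)|` depends only on `|z|`. -/
theorem exists_posLog_norm_eval_congr (P : Polynomial L) : ∃ r > 0, ∀ x u : L, ‖u - x‖ ≤ r →
    Real.posLog ‖P.eval u‖ = Real.posLog ‖P.eval x‖ := by
  obtain ⟨R, hR1, hR, -⟩ := exists_norm_eval_growth P
  obtain ⟨A, hA, hlip⟩ := exists_norm_eval_sub_le P (zero_le_one.trans hR1)
  refine ⟨min 1 (1 / (A + 1)), by positivity, fun x u hxu => ?_⟩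
  rcases le_or_gt ‖x‖ R with hx | hx
  · have hu : ‖u‖ ≤ R := by
      calc ‖u‖ = ‖(u - x) + x‖ := by rw [sub_add_cancel]
        _ ≤ max ‖u - x‖ ‖x‖ := IsUltrametricDist.norm_add_le_max _ _
        _ ≤ R := max_le ((hxu.trans (min_le_left _ _)).trans hR1) hx
    refine posLog_norm_congr ((hlip x u hx hu).trans ?_)
    calc A * ‖u - x‖ ≤ (A + 1) * (1 / (A + 1)) := by
          gcongr
          · linarith
          · exact hxu.trans (min_le_right _ _)
      _ = 1 := by field_simp
  · have hlt : ‖u - x‖ < ‖x‖ := ((hxu.trans (min_le_left _ _)).trans hR1).trans_lt hx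
    have hu : ‖u‖ = ‖x‖ := by
      calc ‖u‖ = ‖(u - x) + x‖ := by rw [sub_add_cancel]
        _ = max ‖u - x‖ ‖x‖ := IsUltrametricDist.norm_add_eq_max_of_norm_ne_norm hlt.ne
        _ = ‖x‖ := max_eq_right hlt.le
    rw [hR x hx, hR u (hu ▸ hx), hu]

theorem exists_abs_posLog_norm_eval_sub_le {P : Polynomial L} (hP : P ≠ 0) : ∃ C, ∀ z : L,
    |Real.posLog ‖P.eval z‖ - P.natDegree * Real.posLog ‖z‖| ≤ C := by
  obtain ⟨R, hR1, hR, hR'⟩ := exists_norm_eval_growth P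
  set a := ‖P.leadingCoeff‖ with ha
  have ha0 : 0 < a := norm_pos_iff.2 (Polynomial.leadingCoeff_ne_zero.2 hP)
  refine ⟨max |Real.log a| (Real.posLog (a * R ^ P.natDegree) + P.natDegree * Real.posLog R),
    fun z => ?_⟩
  rcases le_or_gt ‖z‖ R with hz | hz
  · refine le_max_of_le_right ?_
    have h1 := Real.posLog_le_posLog (norm_nonneg _) (hR' z hz)
    have h2 := mul_le_mul_of_nonneg_left (Real.posLog_le_posLog (norm_nonneg _) hz)
      (Nat.cast_nonneg (α := ℝ) P.natDegree)
    have h3 : 0 ≤ Real.posLog ‖P.eval z‖ := Real.posLog_nonneg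
    have h4 : 0 ≤ P.natDegree * Real.posLog ‖z‖ := mul_nonneg (Nat.cast_nonneg _) Real.posLog_nonneg
    rw [abs_le]
    constructor <;> linarith
  · refine le_max_of_le_left ?_
    have hz1 : 1 < ‖z‖ := hR1.trans_lt hz
    have hB : 0 ≤ P.natDegree * Real.log ‖z‖ :=
      mul_nonneg (Nat.cast_nonneg _) (Real.log_nonneg hz1.le)
    rw [hR z hz, Real.posLog_eq_log (x := ‖z‖) (by rw [abs_norm]; exact hz1.le), Real.posLog_apply,
      Real.log_mul ha0.ne' (pow_pos (by linarith) _).ne', Real.log_pow]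
    rw [abs_le]
    have h1 := le_abs_self (Real.log a)
    have h2 := neg_abs_le (Real.log a)
    constructor
    · have := le_max_right 0 (Real.log a + P.natDegree * Real.log ‖z‖)
      linarith
    · have := max_le (a := 0) (b := Real.log a + P.natDegree * Real.log ‖z‖)
        (c := |Real.log a| + P.natDegree * Real.log ‖z‖) (by positivity) (by linarith)
      linarith

end Polynomials

/-! ### The canonical height as a uniform limit -/

section Height

variable {L : Type*} [NormedField L]

/-- The `n`-th approximation `d⁻ⁿ log⁺ |φⁿ(z)|` of the canonical local height. -/
noncomputable def approxHeight (φ : Polynomial L) (n : ℕ) (z : L) : ℝ :=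
  (1 / (φ.natDegree : ℝ) ^ n) * Real.posLog ‖(fun w => φ.eval w)^[n] z‖

theorem approxHeight_nonneg (φ : Polynomial L) (n : ℕ) (z : L) : 0 ≤ approxHeight φ n z :=
  mul_nonneg (by positivity) Real.posLog_nonneg

theorem iterate_eval_eq (φ : Polynomial L) (n : ℕ) (z : L) :
    (fun w => φ.eval w)^[n] z = (φ.comp^[n] Polynomial.X).eval z := by
  rw [Polynomial.iterate_comp_eval, Polynomial.eval_X]

theorem iterate_mem_filledJuliaSet_iff (φ : Polynomial L) (n : ℕ) (z : L) :
    (fun w => φ.eval w)^[n] z ∈ filledJuliaSet φ ↔ z ∈ filledJuliaSet φ := by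
  simp only [filledJuliaSet, Set.mem_ofPred_eq, ← Function.iterate_add_apply]
  rw [tendsto_add_atTop_iff_nat (f := fun m => ‖(fun w => φ.eval w)^[m] z‖)]

theorem mem_filledJuliaSet_of_eval_eq {φ : Polynomial L} {b : L} (hb : φ.eval b = b) :
    b ∈ filledJuliaSet φ := by
  have : ∀ n, (fun w => φ.eval w)^[n] b = b := fun n => Function.iterate_fixed hb n
  simp only [filledJuliaSet, Set.mem_ofPred_eq, this]
  exact not_tendsto_const_atTop _ _

theorem tendsto_norm_iterate (φ : Polynomial L) {z : L} (hz : z ∉ filledJuliaSet φ) :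
    Tendsto (fun n => ‖(fun w => φ.eval w)^[n] z‖) atTop atTop :=
  not_not.1 hz

theorem exists_eval_eq_self [IsAlgClosed L] {φ : Polynomial L} (hdeg : 2 ≤ φ.natDegree) :
    ∃ b, φ.eval b = b := by
  have hlt : (Polynomial.X : Polynomial L).natDegree < φ.natDegree := by
    rw [Polynomial.natDegree_X]; omega
  have hn : (φ - Polynomial.X).natDegree = φ.natDegree :=
    Polynomial.natDegree_sub_eq_left_of_natDegree_lt hlt
  obtain ⟨b, hb⟩ := IsAlgClosed.exists_root (φ - Polynomial.X) (by
    intro h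
    have : (φ - Polynomial.X).natDegree = 0 := Polynomial.natDegree_eq_of_degree_eq_some h
    rw [hn] at this
    omega)
  exact ⟨b, by simpa [sub_eq_zero] using hb⟩

variable [IsUltrametricDist L] [IsAlgClosed L] {φ : Polynomial L}

/-- Telescoping: consecutive terms differ by `d⁻⁽ⁿ⁺¹⁾` times `log⁺ |φ(w)| - d log⁺ |w|` at `w =
φ^n(z)`, which is bounded. -/
theorem exists_abs_approxHeight_sub_le (hdeg : 2 ≤ φ.natDegree) : ∃ C, 0 ≤ C ∧ ∀ n z,
    |approxHeight φ n z - canonicalLocalHeight φ z| ≤ C * (1 / (φ.natDegree : ℝ)) ^ n := by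
  obtain ⟨C, hC⟩ := exists_abs_posLog_norm_eval_sub_le (P := φ) (by rintro rfl; simp at hdeg)
  set d : ℝ := (φ.natDegree : ℝ) with hd
  have hd2 : (2 : ℝ) ≤ d := by rw [hd]; exact_mod_cast hdeg
  have hd0 : 0 < d := by linarith
  have hr : 1 / d < 1 := by rw [div_lt_one hd0]; linarith
  have hC0 : 0 ≤ C := (abs_nonneg _).trans (hC 0)
  have hstep : ∀ z n, dist (approxHeight φ n z) (approxHeight φ (n + 1) z) ≤ C * (1 / d) ^ n := by
    intro z n
    rw [dist_comm, Real.dist_eq, approxHeight, approxHeight, Function.iterate_succ_apply']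
    have e : ∀ A B : ℝ, 1 / d ^ (n + 1) * A - 1 / d ^ n * B = (1 / d) ^ n * (1 / d) * (A - d * B) := by
      intro A B
      rw [div_pow, one_pow]
      field_simp
      ring
    rw [e, abs_mul, abs_of_nonneg (by positivity)]
    calc _ ≤ (1 / d) ^ n * 1 * C := by
          gcongr
          exact hC _
      _ = _ := by ring
  refine ⟨C / (1 - 1 / d), div_nonneg hC0 (by linarith), fun n z => ?_⟩
  obtain ⟨a, ha⟩ := cauchySeq_tendsto_of_complete (cauchySeq_of_le_geometric _ _ hr (hstep z))
  have hlim : Tendsto (fun n => approxHeight φ n z) atTop (𝓝 (canonicalLocalHeight φ z)) := by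
    have : canonicalLocalHeight φ z = a := ha.limUnder_eq
    rwa [this]
  have := dist_le_of_le_geometric_of_tendsto _ _ hr (hstep z) hlim n
  rw [Real.dist_eq] at this
  refine this.trans_eq ?_
  ring

theorem tendsto_approxHeight (hdeg : 2 ≤ φ.natDegree) (z : L) :
    Tendsto (fun n => approxHeight φ n z) atTop (𝓝 (canonicalLocalHeight φ z)) := by
  obtain ⟨C, -, hC⟩ := exists_abs_approxHeight_sub_le hdeg
  have hd2 : (2 : ℝ) ≤ φ.natDegree := by exact_mod_cast hdeg
  rw [tendsto_iff_dist_tendsto_zero]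
  refine squeeze_zero (fun _ => dist_nonneg) (fun n => hC n z) ?_
  rw [← mul_zero C]
  exact (tendsto_pow_atTop_nhds_zero_of_lt_one (by positivity)
    (by rw [div_lt_one (by linarith)]; linarith)).const_mul C

theorem canonicalLocalHeight_nonneg (hdeg : 2 ≤ φ.natDegree) (z : L) :
    0 ≤ canonicalLocalHeight φ z :=
  ge_of_tendsto' (tendsto_approxHeight hdeg z) fun n => approxHeight_nonneg φ n z

theorem exists_abs_posLog_iterate_sub_le (hdeg : 2 ≤ φ.natDegree) : ∃ C, 0 ≤ C ∧ ∀ n z,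
    |Real.posLog ‖(fun w => φ.eval w)^[n] z‖ -
      (φ.natDegree : ℝ) ^ n * canonicalLocalHeight φ z| ≤ C := by
  obtain ⟨C, hC0, hC⟩ := exists_abs_approxHeight_sub_le hdeg
  refine ⟨C, hC0, fun n z => ?_⟩
  have hd' : (0 : ℝ) < φ.natDegree := by exact_mod_cast (by omega)
  have hd : (0 : ℝ) < (φ.natDegree : ℝ) ^ n := pow_pos hd' n
  have e1 : Real.posLog ‖(fun w => φ.eval w)^[n] z‖ - (φ.natDegree : ℝ) ^ n *
      canonicalLocalHeight φ z =
      (φ.natDegree : ℝ) ^ n * (approxHeight φ n z - canonicalLocalHeight φ z) := by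
    rw [approxHeight, mul_sub, ← mul_assoc, mul_one_div_cancel hd.ne', one_mul]
  rw [e1, abs_mul, abs_of_pos hd]
  refine (mul_le_mul_of_nonneg_left (hC n z) hd.le).trans_eq ?_
  rw [mul_left_comm, ← mul_pow, mul_one_div_cancel hd'.ne', one_pow, mul_one]

/-- Since `log⁺ |φ^n(z)|` is `dⁿ h(z)` up to a bounded error, height zero means a bounded orbit and
positive height forces escape. -/
theorem mem_filledJuliaSet_iff (hdeg : 2 ≤ φ.natDegree) (z : L) :
    z ∈ filledJuliaSet φ ↔ canonicalLocalHeight φ z = 0 := by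
  obtain ⟨C, hC0, hC⟩ := exists_abs_posLog_iterate_sub_le hdeg
  have hd1 : (1 : ℝ) < φ.natDegree := by exact_mod_cast (by omega)
  constructor
  · intro hz
    by_contra hne
    have hpos := (canonicalLocalHeight_nonneg hdeg z).lt_of_ne' hne
    apply hz
    have h1 : Tendsto (fun n => Real.posLog ‖(fun w => φ.eval w)^[n] z‖) atTop atTop := by
      have h2 := ((tendsto_pow_atTop_atTop_of_one_lt hd1).atTop_mul_const hpos).atTop_add
        (tendsto_const_nhds (x := -C))
      refine tendsto_atTop_mono (fun n => ?_) h2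
      have := (abs_le.1 (hC n z)).1
      linarith
    refine tendsto_atTop_mono' _ ?_ (Real.tendsto_exp_atTop.comp h1)
    filter_upwards [h1.eventually_gt_atTop 0] with n hn
    rw [Real.posLog_apply, lt_max_iff] at hn
    have hn := hn.resolve_left (lt_irrefl _)
    simp only [Function.comp, Real.posLog_apply, max_eq_right hn.le]
    refine (Real.exp_log ?_).le
    by_contra h0
    rw [le_antisymm (not_lt.1 h0) (norm_nonneg _)] at hn
    simp at hn
  · intro hz ht
    have h1 : ∀ n, ‖(fun w => φ.eval w)^[n] z‖ ≤ Real.exp C := by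
      intro n
      have := (abs_le.1 (hC n z)).2
      rw [hz, mul_zero, sub_zero, Real.posLog_apply] at this
      have := (le_max_right _ _).trans this
      rcases (norm_nonneg ((fun w => φ.eval w)^[n] z)).eq_or_lt with h0 | h0
      · rw [← h0]; positivity
      · exact (Real.log_le_iff_le_exp h0).1 this
    obtain ⟨n, hn⟩ := (ht.eventually_gt_atTop (Real.exp C)).exists
    exact absurd (h1 n) (not_le.2 hn)

/-- Some `approxHeight φ n` is uniformly close to the height and is constant at a fixed scale. -/
theorem exists_canonicalLocalHeight_le_add (hdeg : 2 ≤ φ.natDegree) {ε : ℝ} (hε : 0 < ε) :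
    ∃ r > 0, ∀ x u : L, ‖u - x‖ ≤ r →
      canonicalLocalHeight φ u ≤ canonicalLocalHeight φ x + ε := by
  obtain ⟨C, hC0, hC⟩ := exists_abs_approxHeight_sub_le hdeg
  have hd2 : (2 : ℝ) ≤ φ.natDegree := by exact_mod_cast hdeg
  have hlim : Tendsto (fun n => C * (1 / (φ.natDegree : ℝ)) ^ n) atTop (𝓝 0) := by
    rw [← mul_zero C]
    exact (tendsto_pow_atTop_nhds_zero_of_lt_one (by positivity)
      (by rw [div_lt_one (by linarith)]; linarith)).const_mul C
  obtain ⟨n, hn⟩ := (hlim.eventually_lt_const (half_pos hε)).exists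
  obtain ⟨r, hr, h⟩ := exists_posLog_norm_eval_congr (φ.comp^[n] Polynomial.X)
  refine ⟨r, hr, fun x u hxu => ?_⟩
  have e : approxHeight φ n u = approxHeight φ n x := by
    rw [approxHeight, approxHeight, iterate_eval_eq, iterate_eval_eq, h x u hxu]
  have h1 := (abs_le.1 (hC n u)).1
  have h2 := (abs_le.1 (hC n x)).2
  linarith

end Height

/-! ### Generic points of discs, and discs around roots -/

section Geometry

theorem norm_sub_eq_max_of_ne {L : Type*} [NormedField L] [IsUltrametricDist L] {u x z : L}
    (h : ‖u - x‖ ≠ ‖x - z‖) :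
    ‖u - z‖ = max ‖u - x‖ ‖x - z‖ := by
  rw [← IsUltrametricDist.norm_add_eq_max_of_norm_ne_norm h, sub_add_sub_cancel]

variable {L : Type*} [NormedField L] [IsAlgClosed L]

theorem exists_norm_mem_Ioo (hL : ∃ c : L, 1 < ‖c‖) {α β : ℝ} (hα : 0 < α) (hαβ : α < β) :
    ∃ t : L, α < ‖t‖ ∧ ‖t‖ < β := by
  obtain ⟨c, hc⟩ := hL
  have hβα : 1 < β / α := (one_lt_div hα).2 hαβ
  obtain ⟨k, hk⟩ := pow_unbounded_of_one_lt ‖c‖ hβα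
  have hk0 : 0 < k := by
    rcases Nat.eq_zero_or_pos k with rfl | h
    · simp at hk; linarith
    · exact h
  obtain ⟨t, ht⟩ := IsAlgClosed.exists_pow_nat_eq c hk0
  rw [← ht, norm_pow] at hc hk
  have ht1 : 1 < ‖t‖ := by
    by_contra h
    exact absurd hc (not_lt.2 (pow_le_one₀ (norm_nonneg _) (not_lt.1 h)))
  have ht2 : ‖t‖ < β / α := lt_of_pow_lt_pow_left₀ k (by linarith) hk
  obtain ⟨n, hn1, hn2⟩ := exists_mem_Ico_zpow hα ht1
  refine ⟨t ^ (n + 1), by rwa [norm_zpow], ?_⟩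
  rw [norm_zpow, zpow_add_one₀ (by linarith)]
  calc ‖t‖ ^ n * ‖t‖ ≤ α * ‖t‖ := by gcongr
    _ < α * (β / α) := by gcongr
    _ = β := by field_simp

/-- The value group is dense and finitely many radii can be avoided. Such a `u` satisfies `|u - z| =
max |u - x| |x - z|` for all `z ∈ Z`, so a truncated distance is almost attained at an actual point.
-/
theorem exists_norm_sub_generic (hL : ∃ c : L, 1 < ‖c‖) {α β : ℝ} (hα : 0 < α) (hαβ : α < β)
    (x : L) {Z : Set L} (hZ : Z.Finite) :
    ∃ u : L, α < ‖u - x‖ ∧ ‖u - x‖ < β ∧ ∀ z ∈ Z, ‖u - x‖ ≠ ‖x - z‖ := by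
  have hY : ((fun z => ‖x - z‖) '' Z).Finite := hZ.image _
  obtain ⟨p, hp, hpY⟩ := ((Set.Ioo_infinite hαβ).sdiff hY).nonempty
  have hopen : IsOpen (Set.Ioo α β ∩ ((fun z => ‖x - z‖) '' Z)ᶜ) :=
    isOpen_Ioo.inter hY.isClosed.isOpen_compl
  obtain ⟨ε, hε, hball⟩ := Metric.isOpen_iff.1 hopen p ⟨hp, hpY⟩
  obtain ⟨t, ht1, ht2⟩ := exists_norm_mem_Ioo hL (hα.trans hp.1) (lt_add_of_pos_right p hε)
  have := hball (show ‖t‖ ∈ Metric.ball p ε by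
    rw [Metric.mem_ball, Real.dist_eq, abs_of_pos (by linarith)]; linarith)
  refine ⟨x + t, ?_⟩
  rw [add_sub_cancel_left]
  exact ⟨this.1.1, this.1.2, fun z hz h => this.2 ⟨z, hz, h.symm⟩⟩

/-- For a trivial absolute value no orbit escapes, so `F = L` would be compact and discrete, hence
finite, whereas an algebraically closed field is infinite. -/
theorem exists_one_lt_norm {φ : Polynomial L} (hF : IsCompact (filledJuliaSet φ)) :
    ∃ c : L, 1 < ‖c‖ := by
  by_contra! h
  have huniv : filledJuliaSet φ = Set.univ := by
    refine Set.eq_univ_of_forall fun z ht => ?_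
    obtain ⟨n, hn⟩ := (ht.eventually_gt_atTop 1).exists
    exact absurd (h _) (not_le.2 hn)
  rw [huniv] at hF
  obtain ⟨t, -, ht, hcov⟩ := hF.finite_cover_balls (zero_lt_one (α := ℝ))
  refine Set.infinite_univ (α := L) (ht.subset fun y _ => ?_)
  obtain ⟨x, hx, hyx⟩ := Set.mem_iUnion₂.1 (hcov (Set.mem_univ y))
  rw [Metric.mem_ball, dist_eq_norm] at hyx
  have : y - x = 0 := by
    by_contra hne
    have h1 := h (y - x)⁻¹
    rw [norm_inv] at h1
    exact absurd h1 (not_le.2 (one_lt_inv₀ (norm_pos_iff.2 hne) |>.2 hyx))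
  rwa [sub_eq_zero.1 this]

variable [IsUltrametricDist L]

/-- Given finitely many balls of radius `r / 2`, a generic point at distance between `r / 2` and `r`
from `x` lies in none of them. -/
theorem not_closedBall_subset_of_isCompact (hL : ∃ c : L, 1 < ‖c‖) {K : Set L} (hK : IsCompact K)
    (x : L) {r : ℝ} (hr : 0 < r) : ∃ u, ‖u - x‖ ≤ r ∧ u ∉ K := by
  by_contra! h
  obtain ⟨t, -, ht, hcov⟩ := hK.finite_cover_balls (half_pos hr)
  obtain ⟨u, hu1, hu2, hu3⟩ := exists_norm_sub_generic hL (half_pos hr) (half_lt_self hr) x ht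
  obtain ⟨y, hy, huy⟩ := Set.mem_iUnion₂.1 (hcov (h u hu2.le))
  rw [Metric.mem_ball, dist_eq_norm, norm_sub_eq_max_of_ne (hu3 y hy)] at huy
  exact absurd (le_max_left _ _) (not_le.2 (huy.trans hu1))

/-- If `P(w)` is small, then `P` is small on the disc through `w` around the root nearest to `w`. -/
theorem exists_root_norm_eval_le (P : Polynomial L) (hP : P.natDegree ≠ 0) (w : L) :
    ∃ z ∈ P.roots, ∀ u, ‖u - z‖ ≤ ‖w - z‖ → ‖P.eval u‖ ≤ ‖P.eval w‖ := by
  classical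
  have hne : P.roots.toFinset.Nonempty := by
    rw [Multiset.toFinset_nonempty, ← Multiset.card_pos, IsAlgClosed.card_roots_eq_natDegree]
    omega
  -- For the root `z` nearest to `w`, every root `a` has `|z - a| ≤ |w - a|`, so no factor `|u - a|`
  -- exceeds `|w - a|`.
  obtain ⟨z, hz, hmin⟩ := P.roots.toFinset.exists_min_image (fun z => ‖w - z‖) hne
  refine ⟨z, Multiset.mem_toFinset.1 hz, fun u hu => ?_⟩
  rw [norm_eval_eq_prod_roots, norm_eval_eq_prod_roots]
  gcongr
  refine Multiset.prod_map_le_prod_map₀ _ _ (fun a _ => norm_nonneg _) fun a ha => ?_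
  have hza := hmin a (Multiset.mem_toFinset.2 ha)
  have h1 : ‖z - a‖ ≤ ‖w - a‖ := by
    calc ‖z - a‖ = ‖(z - w) + (w - a)‖ := by rw [sub_add_sub_cancel]
      _ ≤ max ‖z - w‖ ‖w - a‖ := IsUltrametricDist.norm_add_le_max _ _
      _ ≤ ‖w - a‖ := max_le (by rwa [norm_sub_rev]) le_rfl
  calc ‖u - a‖ = ‖(u - z) + (z - a)‖ := by rw [sub_add_sub_cancel]
    _ ≤ max ‖u - z‖ ‖z - a‖ := IsUltrametricDist.norm_add_le_max _ _
    _ ≤ ‖w - a‖ := max_le (hu.trans hza) h1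

end Geometry

/-! ### Tightness of taut sequences -/

section Tight

variable {L : Type*} [NormedField L]

theorem natDegree_iterate_comp_X_sub_C (φ : Polynomial L) (n : ℕ) (b : L) :
    (φ.comp^[n] Polynomial.X - Polynomial.C b).natDegree = φ.natDegree ^ n := by
  rw [Polynomial.natDegree_sub_C, Polynomial.natDegree_iterate_comp, Polynomial.natDegree_X,
    mul_one]

theorem eval_iterate_comp_X_sub_C (φ : Polynomial L) (n : ℕ) (b z : L) :
    (φ.comp^[n] Polynomial.X - Polynomial.C b).eval z = (fun w => φ.eval w)^[n] z - b := by
  rw [Polynomial.eval_sub, Polynomial.eval_C, ← iterate_eval_eq]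

theorem mem_filledJuliaSet_of_mem_roots {φ : Polynomial L} {b : L} (hb : b ∈ filledJuliaSet φ)
    {n : ℕ} {z : L} (hz : z ∈ (φ.comp^[n] Polynomial.X - Polynomial.C b).roots) :
    z ∈ filledJuliaSet φ := by
  have := Polynomial.isRoot_of_mem_roots hz
  rw [Polynomial.IsRoot, eval_iterate_comp_X_sub_C, sub_eq_zero] at this
  rwa [← iterate_mem_filledJuliaSet_iff φ n, this]

variable [IsUltrametricDist L] [IsAlgClosed L] {φ : Polynomial L}

/-- The height is bounded below away from the filled Julia set. -/
theorem exists_le_canonicalLocalHeight (hdeg : 2 ≤ φ.natDegree)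
    (hF : IsCompact (filledJuliaSet φ)) {δ : ℝ} (hδ : 0 < δ) :
    ∃ η > 0, ∀ z, z ∉ Metric.cthickening δ (filledJuliaSet φ) → η ≤ canonicalLocalHeight φ z := by
  obtain ⟨b, hb⟩ := exists_eval_eq_self hdeg
  have hbF := mem_filledJuliaSet_of_eval_eq hb
  obtain ⟨C, hC0, hC⟩ := exists_abs_posLog_iterate_sub_le hdeg
  set f : L → L := fun w => φ.eval w with hf
  have hd : 0 < φ.natDegree := by omega
  -- `R` dominates both `|b|` and `|φ^n|` on the set where the height is below `d⁻ⁿ`.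
  set R := Real.exp (C + 1 + Real.posLog ‖b‖) with hR
  have hbR : ‖b‖ ≤ R := by
    rcases (norm_nonneg b).eq_or_lt with h | h
    · rw [← h]; positivity
    · rw [← Real.log_le_iff_le_exp h]
      have : Real.log ‖b‖ ≤ Real.posLog ‖b‖ := le_max_right _ _
      linarith
  have hlev : ∀ n z, canonicalLocalHeight φ z < 1 / (φ.natDegree : ℝ) ^ n → ‖f^[n] z‖ ≤ R := by
    intro n z hz
    have hp : (0 : ℝ) < (φ.natDegree : ℝ) ^ n := by positivity
    rw [lt_div_iff₀ hp] at hz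
    have h1 := (abs_le.1 (hC n z)).2
    have h2 : Real.posLog ‖f^[n] z‖ ≤ C + 1 + Real.posLog ‖b‖ := by
      have : 0 ≤ Real.posLog ‖b‖ := Real.posLog_nonneg
      linarith [mul_comm (canonicalLocalHeight φ z) ((φ.natDegree : ℝ) ^ n)]
    rcases (norm_nonneg (f^[n] z)).eq_or_lt with h | h
    · rw [← h]; positivity
    · rw [← Real.log_le_iff_le_exp h]
      exact (le_max_right _ _).trans h2
  by_contra! hcon
  -- A point `w` of tiny height far from `F` is far from every root of `φ^n - b`, since these lie in
  -- `F`. The bound at `w` therefore spreads over a disc of radius `δ` about the nearest root.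
  have hbad : ∀ n, ∃ z ∈ filledJuliaSet φ, ∀ u, ‖u - z‖ ≤ δ → ‖f^[n] u - b‖ ≤ R := by
    intro n
    obtain ⟨w, hw, hwh⟩ := hcon (1 / (φ.natDegree : ℝ) ^ n) (by positivity)
    obtain ⟨z, hz, hzu⟩ := exists_root_norm_eval_le (φ.comp^[n] Polynomial.X - Polynomial.C b)
      (by rw [natDegree_iterate_comp_X_sub_C]; positivity) w
    have hzF := mem_filledJuliaSet_of_mem_roots hbF hz
    refine ⟨z, hzF, fun u hu => ?_⟩
    have hδw : δ ≤ ‖w - z‖ := by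
      by_contra h
      refine hw (Metric.mem_cthickening_of_dist_le w z δ _ hzF ?_)
      rw [dist_eq_norm]; exact (not_le.1 h).le
    have := hzu u (hu.trans hδw)
    rw [eval_iterate_comp_X_sub_C, eval_iterate_comp_X_sub_C] at this
    refine this.trans ?_
    rw [sub_eq_add_neg]
    refine (IsUltrametricDist.norm_add_le_max _ _).trans (max_le (hlev n w hwh) ?_)
    rwa [norm_neg]
  choose z hzF hzu using hbad
  obtain ⟨y, hyF, ψ, hψ, hlim⟩ := hF.tendsto_subseq hzF
  -- Discs of radius `δ` about nearby centres coincide, so the escaping point `u` near the limit `y`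
  -- stays bounded along the subsequence.
  obtain ⟨u, hu, huF⟩ := not_closedBall_subset_of_isCompact (exists_one_lt_norm hF) hF y hδ
  have hev : ∀ᶠ n in atTop, ‖f^[ψ n] u‖ ≤ R := by
    filter_upwards [(Metric.tendsto_nhds.1 hlim) δ hδ] with n hn
    have h1 : ‖u - z (ψ n)‖ ≤ δ := by
      rw [dist_comm, dist_eq_norm] at hn
      calc ‖u - z (ψ n)‖ = ‖(u - y) + (y - z (ψ n))‖ := by rw [sub_add_sub_cancel]
        _ ≤ max ‖u - y‖ ‖y - z (ψ n)‖ := IsUltrametricDist.norm_add_le_max _ _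
        _ ≤ δ := max_le hu hn.le
    calc ‖f^[ψ n] u‖ = ‖(f^[ψ n] u - b) + b‖ := by rw [sub_add_cancel]
      _ ≤ max ‖f^[ψ n] u - b‖ ‖b‖ := IsUltrametricDist.norm_add_le_max _ _
      _ ≤ R := max_le (hzu _ u h1) hbR
  have hinf := (tendsto_norm_iterate φ huF).comp hψ.tendsto_atTop
  obtain ⟨n, hn1, hn2⟩ := (hev.and (hinf.eventually_gt_atTop R)).exists
  exact absurd hn1 (not_le.2 hn2)

theorem isTight_of_isTaut (hdeg : 2 ≤ φ.natDegree) (hF : IsCompact (filledJuliaSet φ))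
    {S : ℕ → Finset L} (hS : IsTaut (canonicalLocalHeight φ) S) :
    IsTight (filledJuliaSet φ) S := by
  classical
  intro δ hδ ε hε
  obtain ⟨η, hη, hlow⟩ := exists_le_canonicalLocalHeight hdeg hF hδ
  obtain ⟨N, hN⟩ := eventually_atTop.1 (hS.eventually_lt_const (mul_pos hε hη))
  refine ⟨N, fun n hn => ?_⟩
  rcases (S n).card.eq_zero_or_pos with h0 | h0
  · rw [h0]; simp
  have hc : (0 : ℝ) < (S n).card := by exact_mod_cast h0
  have h1 := hN n hn
  rw [one_div, inv_mul_lt_iff₀ hc] at h1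
  set A := (S n).filter (· ∈ Metric.cthickening δ (filledJuliaSet φ))
  set B := (S n).filter (· ∉ Metric.cthickening δ (filledJuliaSet φ))
  have hAB : A.card + B.card = (S n).card := Finset.card_filter_add_card_filter_not _
  have h2 : B.card * η ≤ ∑ z ∈ S n, canonicalLocalHeight φ z := by
    rw [← nsmul_eq_mul]
    refine (Finset.card_nsmul_le_sum B _ η fun z hz => hlow z (Finset.mem_filter.1 hz).2).trans ?_
    exact Finset.sum_le_sum_of_subset_of_nonneg (Finset.filter_subset _ _)
      fun z _ _ => canonicalLocalHeight_nonneg hdeg z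
  have h3 : (B.card : ℝ) ≤ ε * (S n).card := by
    have := h2.trans h1.le
    rw [← mul_assoc, mul_comm ((S n).card : ℝ)] at this
    exact le_of_mul_le_mul_right this hη
  have h4 : (A.card : ℝ) + B.card = (S n).card := by exact_mod_cast hAB
  convert (show (1 - ε) * ((S n).card : ℝ) ≤ A.card by linarith) using 1

end Tight

/-! ### Uniform measures with multiplicities -/

section MultisetMeasure

open Classical in
/-- The uniform probability measure on a nonempty multiset. -/
noncomputable def multisetMeasure {M : Type*} [MeasurableSpace M] (s : Multiset M) : Measure M :=
  (s.card : ℝ≥0∞)⁻¹ • ∑ z ∈ s.toFinset, (s.count z : ℝ≥0∞) • Measure.dirac z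

variable {M : Type*} [MeasurableSpace M]

theorem isProbabilityMeasure_multisetMeasure {s : Multiset M} (hs : s.card ≠ 0) :
    IsProbabilityMeasure (multisetMeasure s) := by
  classical
  constructor
  simp only [multisetMeasure, Measure.smul_apply, Measure.finsetSum_apply, smul_eq_mul,
    measure_univ, mul_one]
  rw [← Nat.cast_sum]
  convert ENNReal.inv_mul_cancel (a := (s.card : ℝ≥0∞)) (by exact_mod_cast hs) (by simp) using 3
  exact Multiset.toFinset_sum_count_eq s

theorem multisetMeasure_compl_eq_zero {s : Multiset M} {F : Set M} (hF : MeasurableSet F)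
    (hs : ∀ z ∈ s, z ∈ F) : multisetMeasure s Fᶜ = 0 := by
  classical
  simp only [multisetMeasure, Measure.smul_apply, Measure.finsetSum_apply, smul_eq_mul]
  rw [Finset.sum_eq_zero, mul_zero]
  intro z hz
  rw [Measure.dirac_apply' _ hF.compl, Set.indicator_of_notMem (by
    simpa using hs z (Multiset.mem_toFinset.1 hz)), mul_zero]

theorem integral_multisetMeasure [MeasurableSingletonClass M] (s : Multiset M) (f : M → ℝ) :
    ∫ y, f y ∂(multisetMeasure s) = (s.card : ℝ)⁻¹ * (s.map f).sum := by
  classical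
  rw [multisetMeasure, integral_smul_measure, integral_finsetSum_measure]
  · rw [Finset.sum_multiset_map_count, smul_eq_mul]
    congr 1
    · simp
    · refine Finset.sum_congr (by congr) fun z _ => ?_
      rw [integral_smul_measure, integral_dirac]
      simp only [ENNReal.toReal_natCast, smul_eq_mul, nsmul_eq_mul]
  · intro z _
    exact (integrable_dirac (by simp)).smul_measure (by simp)

end MultisetMeasure

theorem sum_map_neg_log {M : Type*} (s : Multiset M) {g : M → ℝ} (hg : ∀ a, 0 < g a) :
    (s.map fun a => -Real.log (g a)).sum = -Real.log (s.map g).prod := by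
  induction s using Multiset.induction_on with
  | empty => simp
  | cons a s ih =>
    have hpos : 0 < (s.map g).prod := Multiset.prod_pos (by
      intro b hb
      obtain ⟨c, -, rfl⟩ := Multiset.mem_map.1 hb
      exact hg c)
    rw [Multiset.map_cons, Multiset.sum_cons, ih, Multiset.map_cons, Multiset.prod_cons,
      Real.log_mul (hg a).ne' hpos.ne']
    ring

/-! ### The balanced measure and its potential -/

section Potential

variable {L : Type*} [NormedField L] {φ : Polynomial L}

/-- The leading coefficient of `φ^n` is that of `φ` to the power `1 + d + ⋯ + dⁿ⁻¹`. -/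
theorem log_norm_leadingCoeff_iterate (hdeg : 2 ≤ φ.natDegree) (n : ℕ) :
    Real.log ‖(φ.comp^[n] Polynomial.X).leadingCoeff‖ / (φ.natDegree : ℝ) ^ n =
      Real.log ‖φ.leadingCoeff‖ / (φ.natDegree - 1) * (1 - (1 / (φ.natDegree : ℝ)) ^ n) := by
  have hd : (2 : ℝ) ≤ φ.natDegree := by exact_mod_cast hdeg
  have hd0 : (φ.natDegree : ℝ) ≠ 0 := by linarith
  have hd1 : (φ.natDegree : ℝ) - 1 ≠ 0 := by linarith
  have hφ : φ ≠ 0 := by rintro rfl; simp at hdeg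
  induction n with
  | zero => simp
  | succ n ih =>
    have hn : (φ.comp^[n] Polynomial.X).natDegree = φ.natDegree ^ n := by
      rw [Polynomial.natDegree_iterate_comp, Polynomial.natDegree_X, mul_one]
    have hn0 : (φ.comp^[n] Polynomial.X).natDegree ≠ 0 := by
      rw [hn]; exact pow_ne_zero _ (by omega)
    have hne : (φ.comp^[n] Polynomial.X) ≠ 0 := by rintro h; simp [h] at hn0
    rw [Function.iterate_succ_apply', Polynomial.leadingCoeff_comp hn0, norm_mul, norm_pow,
      Real.log_mul (by simpa using hφ) (pow_ne_zero _ (by simpa using hne)), Real.log_pow]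
    rw [div_eq_iff (pow_ne_zero _ hd0)] at ih
    rw [ih, one_div, inv_pow, inv_pow]
    field_simp
    ring

theorem leadingCoeff_iterate_comp_X_sub_C (hdeg : 2 ≤ φ.natDegree) (n : ℕ) (b : L) :
    (φ.comp^[n] Polynomial.X - Polynomial.C b).leadingCoeff =
      (φ.comp^[n] Polynomial.X).leadingCoeff := by
  refine Polynomial.leadingCoeff_sub_of_degree_lt (Polynomial.degree_C_le.trans_lt ?_)
  rw [← Polynomial.natDegree_pos_iff_degree_pos, Polynomial.natDegree_iterate_comp,
    Polynomial.natDegree_X, mul_one]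
  exact pow_pos (by omega) _

theorem leadingCoeff_iterate_ne_zero (hdeg : 2 ≤ φ.natDegree) (n : ℕ) :
    (φ.comp^[n] Polynomial.X).leadingCoeff ≠ 0 := by
  rw [Polynomial.leadingCoeff_ne_zero]
  intro h
  have : (φ.comp^[n] Polynomial.X).natDegree = φ.natDegree ^ n := by
    rw [Polynomial.natDegree_iterate_comp, Polynomial.natDegree_X, mul_one]
  rw [h, Polynomial.natDegree_zero] at this
  exact (pow_pos (by omega : 0 < φ.natDegree) n).ne this

variable [IsAlgClosed L] [MeasurableSpace L]

/-- The uniform measure on the `n`-th preimages of `b`, counted with multiplicities. -/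
noncomputable def preimageMeasure (φ : Polynomial L) (b : L) (n : ℕ) : Measure L :=
  multisetMeasure (φ.comp^[n] Polynomial.X - Polynomial.C b).roots

theorem isProbabilityMeasure_preimageMeasure (hdeg : 2 ≤ φ.natDegree) (b : L) (n : ℕ) :
    IsProbabilityMeasure (preimageMeasure φ b n) := by
  refine isProbabilityMeasure_multisetMeasure ?_
  rw [IsAlgClosed.card_roots_eq_natDegree, natDegree_iterate_comp_X_sub_C]
  exact pow_ne_zero _ (by omega)

theorem integral_truncLog_preimageMeasure [BorelSpace L] (b : L) (n : ℕ) {r : ℝ} (hr : 0 < r)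
    (x : L) : ∫ y, truncLog r x y ∂(preimageMeasure φ b n) =
      -Real.log (((φ.comp^[n] Polynomial.X - Polynomial.C b).roots.map
        fun z => max ‖x - z‖ r).prod) / (φ.natDegree : ℝ) ^ n := by
  rw [preimageMeasure, integral_multisetMeasure, IsAlgClosed.card_roots_eq_natDegree,
    natDegree_iterate_comp_X_sub_C, ← sum_map_neg_log _ fun z => lt_max_of_lt_right hr,
    inv_mul_eq_div, Nat.cast_pow]
  congr 2
  exact Multiset.map_congr rfl fun z _ => by rw [truncLog, dist_eq_norm]

variable [IsUltrametricDist L]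

theorem le_integral_truncLog_preimageMeasure [BorelSpace L] (hdeg : 2 ≤ φ.natDegree)
    (hL : ∃ c : L, 1 < ‖c‖) (b : L) :
    ∃ C, ∀ ε > 0, ∃ r₀ > 0, ∀ r, 0 < r → r ≤ r₀ → ∀ x n,
      Real.log ‖φ.leadingCoeff‖ / (φ.natDegree - 1) * (1 - (1 / (φ.natDegree : ℝ)) ^ n) -
        canonicalLocalHeight φ x - ε - C * (1 / (φ.natDegree : ℝ)) ^ n ≤
      ∫ y, truncLog r x y ∂(preimageMeasure φ b n) := by
  classical
  obtain ⟨C, hC0, hC⟩ := exists_abs_approxHeight_sub_le hdeg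
  refine ⟨C + Real.posLog ‖b‖, fun ε hε => ?_⟩
  obtain ⟨r₀, hr₀, hcont⟩ := exists_canonicalLocalHeight_le_add hdeg hε
  -- The generic point replacing the truncation lies within `2 r` of `x`, and the height must be
  -- controlled there; hence the factor `1 / 2`.
  refine ⟨r₀ / 2, half_pos hr₀, fun r hr hr' x n => ?_⟩
  set P := φ.comp^[n] Polynomial.X - Polynomial.C b with hP
  obtain ⟨u, hu1, hu2, hu3⟩ := exists_norm_sub_generic hL hr (by linarith : r < r + r) x
    (P.roots.toFinset.finite_toSet)
  have hd : (0 : ℝ) < (φ.natDegree : ℝ) ^ n := pow_pos (by exact_mod_cast (by omega)) n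
  have hlc : 0 < ‖(φ.comp^[n] Polynomial.X).leadingCoeff‖ :=
    norm_pos_iff.2 (leadingCoeff_iterate_ne_zero hdeg n)
  have hprod : (P.roots.map fun z => max ‖x - z‖ r).prod ≤ (P.roots.map fun z => ‖u - z‖).prod := by
    refine Multiset.prod_map_le_prod_map₀ _ _ (fun a _ => hr.le.trans (le_max_right _ _))
      fun z hz => ?_
    rw [norm_sub_eq_max_of_ne (hu3 z (Finset.mem_coe.2 (Multiset.mem_toFinset.2 hz))), max_comm]
    exact max_le_max_right _ hu1.le
  have hpos : 0 < (P.roots.map fun z => max ‖x - z‖ r).prod := Multiset.prod_pos (by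
    intro a ha
    obtain ⟨z, -, rfl⟩ := Multiset.mem_map.1 ha
    exact lt_max_of_lt_right hr)
  have heval := norm_eval_eq_prod_roots P u
  rw [hP, eval_iterate_comp_X_sub_C, leadingCoeff_iterate_comp_X_sub_C hdeg, ← hP] at heval
  have hlog : Real.log ((P.roots.map fun z => max ‖x - z‖ r).prod) ≤
      Real.posLog ‖(fun w => φ.eval w)^[n] u‖ + Real.posLog ‖b‖ -
        Real.log ‖(φ.comp^[n] Polynomial.X).leadingCoeff‖ := by
    refine (Real.log_le_log hpos hprod).trans ?_
    have hpos' := hpos.trans_le hprod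
    rw [le_sub_iff_add_le, add_comm, ← Real.log_mul hlc.ne' hpos'.ne', ← heval]
    have h1 : ‖(fun w => φ.eval w)^[n] u - b‖ ≤ max ‖(fun w => φ.eval w)^[n] u‖ ‖b‖ := by
      rw [sub_eq_add_neg, ← norm_neg b]
      exact IsUltrametricDist.norm_add_le_max _ _
    refine (le_max_right 0 _).trans ((Real.posLog_le_posLog (norm_nonneg _) h1).trans ?_)
    rcases max_choice ‖(fun w => φ.eval w)^[n] u‖ ‖b‖ with h | h <;> rw [h]
    · exact le_add_of_nonneg_right Real.posLog_nonneg
    · exact le_add_of_nonneg_left Real.posLog_nonneg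
  rw [integral_truncLog_preimageMeasure b n hr, ← hP, ← log_norm_leadingCoeff_iterate hdeg]
  have h1 := (abs_le.1 (hC n u)).2
  have h2 := hcont x u (by linarith)
  have h3 : -Real.log ((P.roots.map fun z => max ‖x - z‖ r).prod) / (φ.natDegree : ℝ) ^ n ≥
      Real.log ‖(φ.comp^[n] Polynomial.X).leadingCoeff‖ / (φ.natDegree : ℝ) ^ n -
        approxHeight φ n u - Real.posLog ‖b‖ * (1 / (φ.natDegree : ℝ)) ^ n := by
    rw [approxHeight, div_pow, one_pow, ge_iff_le, le_div_iff₀ hd]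
    have : (Real.log ‖(φ.comp^[n] Polynomial.X).leadingCoeff‖ / (φ.natDegree : ℝ) ^ n -
        1 / (φ.natDegree : ℝ) ^ n * Real.posLog ‖(fun w => φ.eval w)^[n] u‖ -
        Real.posLog ‖b‖ * (1 / (φ.natDegree : ℝ) ^ n)) * (φ.natDegree : ℝ) ^ n =
        Real.log ‖(φ.comp^[n] Polynomial.X).leadingCoeff‖ -
          Real.posLog ‖(fun w => φ.eval w)^[n] u‖ - Real.posLog ‖b‖ := by
      field_simp
    rw [this]
    linarith
  linarith

theorem eventually_integral_truncLog_preimageMeasure_le [BorelSpace L] (hdeg : 2 ≤ φ.natDegree)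
    (hF : IsCompact (filledJuliaSet φ)) (b : L) (x : L) {r : ℝ} (hr : 0 < r) :
    ∀ᶠ n in atTop, ∫ y, truncLog r x y ∂(preimageMeasure φ b n) ≤
      Real.log ‖φ.leadingCoeff‖ / (φ.natDegree - 1) * (1 - (1 / (φ.natDegree : ℝ)) ^ n) := by
  -- An escaping `u` within `r` of `x` has `|u - z| ≤ max |x - z| r` for each root `z`, so the
  -- truncated product dominates `|φ^n(u) - b| / |aₙ|`, with numerator eventually at least `1`.
  obtain ⟨u, hu, huF⟩ := not_closedBall_subset_of_isCompact (exists_one_lt_norm hF) hF x hr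
  filter_upwards [(tendsto_norm_iterate φ huF).eventually_ge_atTop (1 + ‖b‖)] with n hn
  rw [integral_truncLog_preimageMeasure b n hr, ← log_norm_leadingCoeff_iterate hdeg]
  set P := φ.comp^[n] Polynomial.X - Polynomial.C b with hP
  have hd : (0 : ℝ) < (φ.natDegree : ℝ) ^ n := pow_pos (by exact_mod_cast (by omega)) n
  have hlc : 0 < ‖(φ.comp^[n] Polynomial.X).leadingCoeff‖ :=
    norm_pos_iff.2 (leadingCoeff_iterate_ne_zero hdeg n)
  have hprod : (P.roots.map fun z => ‖u - z‖).prod ≤ (P.roots.map fun z => max ‖x - z‖ r).prod := by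
    refine Multiset.prod_map_le_prod_map₀ _ _ (fun a _ => norm_nonneg _) fun z _ => ?_
    calc ‖u - z‖ = ‖(x - z) + (u - x)‖ := by rw [add_comm, sub_add_sub_cancel]
      _ ≤ max ‖x - z‖ ‖u - x‖ := IsUltrametricDist.norm_add_le_max _ _
      _ ≤ max ‖x - z‖ r := max_le_max_left _ hu
  have heval := norm_eval_eq_prod_roots P u
  rw [hP, eval_iterate_comp_X_sub_C, leadingCoeff_iterate_comp_X_sub_C hdeg, ← hP] at heval
  have h1 : 1 ≤ ‖(fun w => φ.eval w)^[n] u - b‖ := by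
    have := norm_sub_norm_le ((fun w => φ.eval w)^[n] u) b
    linarith
  have hpos : 0 < (P.roots.map fun z => max ‖x - z‖ r).prod := Multiset.prod_pos (by
    intro a ha
    obtain ⟨z, -, rfl⟩ := Multiset.mem_map.1 ha
    exact lt_max_of_lt_right hr)
  gcongr
  rw [neg_le_iff_add_nonneg, ← Real.log_mul hlc.ne' hpos.ne']
  refine Real.log_nonneg (h1.trans ?_)
  rw [heval]
  gcongr

/-- The balanced measure of the dynamical system: its potential is controlled by the height. -/
theorem exists_measure_integral_truncLog [BorelSpace L] (hdeg : 2 ≤ φ.natDegree)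
    (hF : IsCompact (filledJuliaSet φ)) :
    ∃ (μ : Measure L) (V : ℝ), IsProbabilityMeasure μ ∧ μ (filledJuliaSet φ)ᶜ = 0 ∧
      (∀ ε > 0, ∃ r₀ > 0, ∀ r, 0 < r → r ≤ r₀ → ∀ x,
        V - canonicalLocalHeight φ x - ε ≤ ∫ y, truncLog r x y ∂μ) ∧
      ∀ x r, 0 < r → ∫ y, truncLog r x y ∂μ ≤ V := by
  set F := filledJuliaSet φ
  obtain ⟨b, hb⟩ := exists_eval_eq_self hdeg
  have hbF : b ∈ F := mem_filledJuliaSet_of_eval_eq hb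
  have hmeas : MeasurableSet F := hF.measurableSet
  have hprob := isProbabilityMeasure_preimageMeasure (φ := φ) hdeg b
  have hsupp : ∀ n, preimageMeasure φ b n Fᶜ = 0 := fun n =>
    multisetMeasure_compl_eq_zero hmeas fun z hz => mem_filledJuliaSet_of_mem_roots hbF hz
  set ρ : ℕ → ProbabilityMeasure L := fun n => ⟨preimageMeasure φ b n, hprob n⟩ with hρ
  -- All these measures live on the compact set `F`, so they have a weak limit along an ultrafilter;
  -- the estimates pass to it.
  have hK := isCompact_setOfPred_probabilityMeasure_mass_eq_compl_isCompact_le (E := L)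
    (u := fun _ => 0) (K := fun _ => F) tendsto_const_nhds (fun _ => hF) (Or.inr monotone_const)
  obtain ⟨μ, hμK, hμ⟩ := hK.ultrafilter_le_nhds ((hyperfilter ℕ).map ρ) (by
    rw [le_principal_iff]
    refine Filter.mem_map.2 (univ_mem' fun n => ?_)
    intro _
    have : (ρ n) Fᶜ = 0 := by
      rw [← ENNReal.coe_eq_zero, ProbabilityMeasure.ennreal_coeFn_eq_coeFn_toMeasure]
      exact hsupp n
    exact this.le)
  have hμF : (μ : Measure L) Fᶜ = 0 := by
    rw [← ProbabilityMeasure.ennreal_coeFn_eq_coeFn_toMeasure, ENNReal.coe_eq_zero]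
    exact le_antisymm (hμK 0) zero_le
  have hconv : Tendsto ρ (hyperfilter ℕ : Filter ℕ) (𝓝 μ) := hμ
  have hint : ∀ x r, 0 < r → Tendsto (fun n => ∫ y, truncLog r x y ∂(preimageMeasure φ b n))
      (hyperfilter ℕ : Filter ℕ) (𝓝 (∫ y, truncLog r x y ∂(μ : Measure L))) := by
    intro x r hr
    obtain ⟨B, hB⟩ := (hF.image (continuous_truncLog hr x)).bddBelow
    -- The test function need not be bounded below on `L`; cutting it at its lower bound on `F` does
    -- not change the integrals.
    set g : L → ℝ := fun y => max (truncLog r x y) B with hg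
    have hgc : Continuous g := (continuous_truncLog hr x).max continuous_const
    have hgb : ∀ y z, dist (g y) (g z) ≤ max (-Real.log r) B - B := by
      have h1 : ∀ y, B ≤ g y := fun y => le_max_right _ _
      have h2 : ∀ y, g y ≤ max (-Real.log r) B := fun y => max_le_max_right _ (truncLog_le hr x y)
      intro y z
      rw [Real.dist_eq, abs_le]
      constructor <;> linarith [h1 y, h1 z, h2 y, h2 z]
    have hlim := (ProbabilityMeasure.tendsto_iff_forall_integral_tendsto.1 hconv)
      (BoundedContinuousFunction.mkOfBound ⟨g, hgc⟩ _ hgb)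
    have heq : ∀ ν : Measure L, ν Fᶜ = 0 → ∫ y, g y ∂ν = ∫ y, truncLog r x y ∂ν := by
      intro ν hν
      have hae : ∀ᵐ y ∂ν, y ∈ F := by rwa [ae_iff]
      exact integral_congr_ae (hae.mono fun y hy => max_eq_left (hB ⟨y, hy, rfl⟩))
    rw [← heq _ hμF]
    refine hlim.congr fun n => ?_
    exact heq _ (hsupp n)
  have hd2 : (2 : ℝ) ≤ φ.natDegree := by exact_mod_cast hdeg
  have hgeom : Tendsto (fun n => (1 / (φ.natDegree : ℝ)) ^ n) (hyperfilter ℕ : Filter ℕ) (𝓝 0) :=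
    (tendsto_pow_atTop_nhds_zero_of_lt_one (by positivity)
      (by rw [div_lt_one (by linarith)]; linarith)).mono_left Nat.hyperfilter_le_atTop
  set V := Real.log ‖φ.leadingCoeff‖ / (φ.natDegree - 1) with hV
  have hl : Tendsto (fun n => V * (1 - (1 / (φ.natDegree : ℝ)) ^ n)) (hyperfilter ℕ : Filter ℕ)
      (𝓝 V) := by
    have := (hgeom.const_sub 1).const_mul V
    simpa using this
  refine ⟨μ, V, inferInstance, hμF, fun ε hε => ?_, fun x r hr => ?_⟩
  · obtain ⟨C, hC⟩ := le_integral_truncLog_preimageMeasure hdeg (exists_one_lt_norm hF) b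
    obtain ⟨r₀, hr₀, h⟩ := hC ε hε
    refine ⟨r₀, hr₀, fun r hr hr' x => ?_⟩
    refine le_of_tendsto_of_tendsto' ?_ (hint x r hr) (fun n => h r hr hr' x n)
    have := ((hl.sub_const (canonicalLocalHeight φ x)).sub_const ε).sub (hgeom.const_mul C)
    simpa using this
  · refine le_of_tendsto_of_tendsto (hint x r hr) hl ?_
    exact Nat.hyperfilter_le_atTop
      (eventually_integral_truncLog_preimageMeasure_le hdeg hF b x hr)

end Potential

/-! ### Energy as a limit of truncated energies -/

section Energy

variable {M : Type*} [MetricSpace M]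

theorem logKernel_self (x : M) : logKernel x x = ⊤ := by
  simp [logKernel]

theorem logKernel_of_ne {x y : M} (h : x ≠ y) :
    logKernel x y = ((-Real.log (dist x y) : ℝ) : EReal) := by
  rw [logKernel, edist_dist, ENNReal.log_ofReal_of_pos (dist_pos.2 h), EReal.coe_neg]

theorem truncLog_le_logKernel {r : ℝ} (x y : M) : (truncLog r x y : EReal) ≤ logKernel x y := by
  by_cases h : x = y
  · rw [h, logKernel_self]; exact le_top
  · rw [logKernel_of_ne h, EReal.coe_le_coe_iff, truncLog]
    exact neg_le_neg (Real.log_le_log (dist_pos.2 h) (le_max_left _ _))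

/-- Truncation at a radius at most `1` only alters the kernel where it is nonnegative, so all
truncations share one finite negative part. -/
theorem toENNReal_neg_logKernel {r : ℝ} (hr : 0 < r) (hr1 : r ≤ 1) (x y : M) :
    (-logKernel x y).toENNReal = ENNReal.ofReal (-truncLog r x y) := by
  by_cases h : x = y
  · rw [h, logKernel_self]
    have : Real.log r ≤ 0 := Real.log_nonpos hr.le hr1
    simp [truncLog, hr.le, this]
  · rw [logKernel_of_ne h, ← EReal.coe_neg, EReal.real_coe_toENNReal, truncLog, neg_neg, neg_neg]
    rcases le_total r (dist x y) with hd | hd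
    · rw [max_eq_left hd]
    · rw [max_eq_right hd, ENNReal.ofReal_of_nonpos (Real.log_nonpos hr.le hr1),
        ENNReal.ofReal_of_nonpos (Real.log_nonpos dist_nonneg (hd.trans hr1))]

theorem tendsto_ofReal_truncLog (x y : M) :
    Tendsto (fun m : ℕ => ENNReal.ofReal (truncLog (1 / ((m : ℝ) + 1)) x y)) atTop
      (𝓝 (logKernel x y).toENNReal) := by
  by_cases h : x = y
  · subst h
    rw [logKernel_self, EReal.toENNReal_top]
    refine ENNReal.tendsto_ofReal_atTop.comp ?_
    have : (fun m : ℕ => truncLog (1 / ((m : ℝ) + 1)) x x) = fun m : ℕ => Real.log ((m : ℝ) + 1) := by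
      funext m
      have : (0 : ℝ) ≤ 1 / ((m : ℝ) + 1) := by positivity
      rw [truncLog, dist_self, max_eq_right this, one_div, Real.log_inv, neg_neg]
    rw [this]
    exact Real.tendsto_log_atTop.comp (tendsto_natCast_atTop_atTop.atTop_add tendsto_const_nhds)
  · refine tendsto_const_nhds.congr' ?_
    filter_upwards [tendsto_one_div_add_atTop_nhds_zero_nat.eventually_le_const (dist_pos.2 h)]
      with m hm
    rw [logKernel_of_ne h, EReal.real_coe_toENNReal, truncLog, max_eq_left hm]

variable [MeasurableSpace M]

theorem integrable_of_continuous_of_compl_eq_zero [BorelSpace M] {C : Set M} (hC : IsCompact C)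
    {ν : Measure M} [IsProbabilityMeasure ν] (hν : ν Cᶜ = 0) {f : M → ℝ} (hf : Continuous f) :
    Integrable f ν := by
  have h := hf.continuousOn.integrableOn_compact (μ := ν) hC
  have hae : ∀ᵐ y ∂ν, y ∈ C := by rwa [ae_iff]
  rwa [IntegrableOn, Measure.restrict_eq_self_of_ae_mem hae] at h

theorem lintegral_lintegral_ofReal [BorelSpace M] {C : Set M} (hC : IsCompact C) {ν : Measure M}
    [IsProbabilityMeasure ν] (hν : ν Cᶜ = 0) {r : ℝ} (hr : 0 < r) {q : M → M → ℝ}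
    (hq0 : ∀ x y, 0 ≤ q x y) (hq : ∀ x y z, dist y z ≤ r → q x y = q x z)
    (hq' : ∀ x y z, dist y z ≤ r → q y x = q z x) :
    ∫⁻ x, ∫⁻ y, ENNReal.ofReal (q x y) ∂ν ∂ν = ENNReal.ofReal (∫ x, ∫ y, q x y ∂ν ∂ν) := by
  have h1 : ∀ x, Integrable (q x) ν := fun x =>
    integrable_of_continuous_of_compl_eq_zero hC hν (continuous_of_locally_const hr (hq x))
  have h2 : Integrable (fun x => ∫ y, q x y ∂ν) ν := by
    refine integrable_of_continuous_of_compl_eq_zero hC hν (continuous_of_locally_const hr ?_)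
    intro y z h
    simp only [hq' _ y z h]
  rw [ofReal_integral_eq_lintegral_ofReal h2
    (ae_of_all _ fun x => integral_nonneg fun y => hq0 x y)]
  refine lintegral_congr fun x => ?_
  rw [ofReal_integral_eq_lintegral_ofReal (h1 x) (ae_of_all _ fun y => hq0 x y)]

variable [BorelSpace M] [IsUltrametricDist M]

theorem integral_integral_truncLog_eq {C : Set M} (hC : IsCompact C) {ν : Measure M}
    [IsProbabilityMeasure ν] (hν : ν Cᶜ = 0) {r : ℝ} (hr : 0 < r) :
    ∫ x, ∫ y, truncLog r x y ∂ν ∂ν = ∫ x, ∫ y, max (truncLog r x y) 0 ∂ν ∂ν -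
      ∫ x, ∫ y, max (-truncLog r x y) 0 ∂ν ∂ν := by
  have h1 : ∀ g : ℝ → ℝ, ∀ x, Integrable (fun y => g (truncLog r x y)) ν := fun g x =>
    integrable_of_continuous_of_compl_eq_zero hC hν (continuous_of_locally_const hr fun y z h => by
      rw [truncLog_congr_right h])
  have h2 : ∀ g : ℝ → ℝ, Integrable (fun x => ∫ y, g (truncLog r x y) ∂ν) ν := fun g =>
    integrable_of_continuous_of_compl_eq_zero hC hν (continuous_of_locally_const hr fun y z h => by
      simp only [truncLog_congr_left h])
  rw [← integral_sub (h2 fun t => max t 0) (h2 fun t => max (-t) 0)]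
  refine integral_congr_ae (ae_of_all _ fun x => ?_)
  simp only
  rw [← integral_sub (h1 (fun t => max t 0) x) (h1 (fun t => max (-t) 0) x)]
  refine integral_congr_ae (ae_of_all _ fun y => ?_)
  simp only
  rcases le_total 0 (truncLog r x y) with h | h
  · rw [max_eq_left h, max_eq_right (neg_nonpos.2 h), sub_zero]
  · rw [max_eq_right h, max_eq_left (neg_nonneg.2 h), zero_sub, neg_neg]

theorem lintegral_neg_logKernel {C : Set M} (hC : IsCompact C) {ν : Measure M}
    [IsProbabilityMeasure ν] (hν : ν Cᶜ = 0) {r : ℝ} (hr : 0 < r) (hr1 : r ≤ 1) :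
    ∫⁻ x, ∫⁻ y, (-logKernel x y).toENNReal ∂ν ∂ν =
      ENNReal.ofReal (∫ x, ∫ y, max (-truncLog r x y) 0 ∂ν ∂ν) := by
  rw [← lintegral_lintegral_ofReal hC hν hr (fun _ _ => le_max_right _ _)
    (fun x y z h => by rw [truncLog_congr_right h]) (fun x y z h => by rw [truncLog_congr_left h])]
  refine lintegral_congr fun x => lintegral_congr fun y => ?_
  rw [toENNReal_neg_logKernel hr hr1, ENNReal.ofReal_max, ENNReal.ofReal_zero]
  simp

theorem integral_integral_truncLog_le_energy {C : Set M} (hC : IsCompact C) {ν : Measure M}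
    [IsProbabilityMeasure ν] (hν : ν Cᶜ = 0) {r : ℝ} (hr : 0 < r) (hr1 : r ≤ 1) :
    ((∫ x, ∫ y, truncLog r x y ∂ν ∂ν : ℝ) : EReal) ≤ energy ν := by
  rw [energy, integral_integral_truncLog_eq hC hν hr, lintegral_neg_logKernel hC hν hr hr1,
    EReal.coe_sub]
  refine EReal.sub_le_sub ?_ ?_
  · have h : ENNReal.ofReal (∫ x, ∫ y, max (truncLog r x y) 0 ∂ν ∂ν) ≤
        ∫⁻ x, ∫⁻ y, (logKernel x y).toENNReal ∂ν ∂ν := by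
      rw [← lintegral_lintegral_ofReal hC hν hr (fun _ _ => le_max_right _ _)
        (fun x y z h => by rw [truncLog_congr_right h])
        (fun x y z h => by rw [truncLog_congr_left h])]
      refine lintegral_mono fun x => lintegral_mono fun y => ?_
      simp only
      rw [ENNReal.ofReal_max, ENNReal.ofReal_zero, max_eq_left zero_le,
        ← EReal.real_coe_toENNReal]
      exact EReal.toENNReal_le_toENNReal (truncLog_le_logKernel x y)
    refine le_trans ?_ (EReal.coe_ennreal_le_coe_ennreal_iff.2 h)
    rw [EReal.coe_ennreal_ofReal]
    exact EReal.coe_le_coe_iff.2 (le_max_left _ _)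
  · have hN : 0 ≤ ∫ x, ∫ y, max (-truncLog r x y) 0 ∂ν ∂ν :=
      integral_nonneg fun x => integral_nonneg fun y => le_max_right _ _
    rw [EReal.coe_ennreal_ofReal, max_eq_left hN]

/-- Fatou's lemma, applied twice to the positive parts along `r = 1 / (m + 1)`; the negative part is
the same number `N` throughout. -/
theorem energy_le_of_integral_integral_truncLog_le {C : Set M} (hC : IsCompact C) {ν : Measure M}
    [IsProbabilityMeasure ν] (hν : ν Cᶜ = 0) {V : ℝ}
    (h : ∀ r, 0 < r → ∫ x, ∫ y, truncLog r x y ∂ν ∂ν ≤ V) : energy ν ≤ V := by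
  set N : ℝ := ∫ x, ∫ y, max (-truncLog 1 x y) 0 ∂ν ∂ν with hN
  have hN0 : ∀ r, 0 ≤ ∫ x, ∫ y, max (-truncLog r x y) 0 ∂ν ∂ν := fun r =>
    integral_nonneg fun x => integral_nonneg fun y => le_max_right _ _
  have hP0 : ∀ r, 0 ≤ ∫ x, ∫ y, max (truncLog r x y) 0 ∂ν ∂ν := fun r =>
    integral_nonneg fun x => integral_nonneg fun y => le_max_right _ _
  have hNr : ∀ r, 0 < r → r ≤ 1 → ∫ x, ∫ y, max (-truncLog r x y) 0 ∂ν ∂ν = N := by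
    intro r hr hr1
    have := (lintegral_neg_logKernel hC hν hr hr1).symm.trans
      (lintegral_neg_logKernel hC hν one_pos le_rfl)
    rwa [ENNReal.ofReal_eq_ofReal_iff (hN0 _) (hN0 _)] at this
  have hr : ∀ m : ℕ, (0 : ℝ) < 1 / ((m : ℝ) + 1) := fun m => by positivity
  have hr1 : ∀ m : ℕ, 1 / ((m : ℝ) + 1) ≤ 1 := fun m => by
    rw [div_le_one (by positivity)]; linarith [(Nat.cast_nonneg m : (0 : ℝ) ≤ m)]
  have hP : ∀ m : ℕ, ∫ x, ∫ y, max (truncLog (1 / ((m : ℝ) + 1)) x y) 0 ∂ν ∂ν ≤ V + N := by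
    intro m
    have h1 := h _ (hr m)
    rw [integral_integral_truncLog_eq hC hν (hr m), hNr _ (hr m) (hr1 m)] at h1
    linarith
  have hVN : 0 ≤ V + N := (hP0 _).trans (hP 0)
  have hcont : ∀ m : ℕ, Measurable fun x =>
      ∫⁻ y, ENNReal.ofReal (truncLog (1 / ((m : ℝ) + 1)) x y) ∂ν :=
    fun m => (continuous_of_locally_const (hr m) fun y z h => by
      simp only [truncLog_congr_left h]).measurable
  have hup : ∫⁻ x, ∫⁻ y, (logKernel x y).toENNReal ∂ν ∂ν ≤ ENNReal.ofReal (V + N) := by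
    calc ∫⁻ x, ∫⁻ y, (logKernel x y).toENNReal ∂ν ∂ν
        = ∫⁻ x, ∫⁻ y, liminf (fun m : ℕ => ENNReal.ofReal (truncLog (1 / ((m : ℝ) + 1)) x y)) atTop
            ∂ν ∂ν := by
          refine lintegral_congr fun x => lintegral_congr fun y => ?_
          exact (tendsto_ofReal_truncLog x y).liminf_eq.symm
      _ ≤ ∫⁻ x, liminf (fun m : ℕ => ∫⁻ y, ENNReal.ofReal (truncLog (1 / ((m : ℝ) + 1)) x y) ∂ν)
            atTop ∂ν := by
          refine lintegral_mono fun x => lintegral_liminf_le fun m => ?_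
          exact (continuous_truncLog (hr m) x).measurable.ennreal_ofReal
      _ ≤ liminf (fun m : ℕ => ∫⁻ x, ∫⁻ y,
            ENNReal.ofReal (truncLog (1 / ((m : ℝ) + 1)) x y) ∂ν ∂ν) atTop :=
          lintegral_liminf_le hcont
      _ ≤ ENNReal.ofReal (V + N) := by
          refine liminf_le_of_le (by isBoundedDefault) fun b hb => ?_
          obtain ⟨m, hm⟩ := hb.exists
          refine hm.trans ((lintegral_mono fun x => lintegral_mono fun y =>
            ENNReal.ofReal_le_ofReal (le_max_left _ 0)).trans ?_)
          rw [lintegral_lintegral_ofReal hC hν (hr m) (fun _ _ => le_max_right _ _)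
            (fun x y z h => by rw [truncLog_congr_right h])
            (fun x y z h => by rw [truncLog_congr_left h])]
          exact ENNReal.ofReal_le_ofReal (hP m)
  rw [energy, lintegral_neg_logKernel hC hν one_pos le_rfl, ← hN]
  calc _ ≤ ((ENNReal.ofReal (V + N) : ℝ≥0∞) : EReal) - ((ENNReal.ofReal N : ℝ≥0∞) : EReal) :=
        EReal.sub_le_sub (EReal.coe_ennreal_le_coe_ennreal_iff.2 hup) le_rfl
    _ = (V : EReal) := by
        rw [EReal.coe_ennreal_ofReal, EReal.coe_ennreal_ofReal, max_eq_left hVN,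
          max_eq_left (hN0 1), ← EReal.coe_sub, add_sub_cancel_right]

end Energy

/-! ### Uniform measures on finite sets -/

section UniformMeasure

variable {M : Type*} [MeasurableSpace M]

theorem isProbabilityMeasure_uniformMeasure [MetricSpace M] {S : Finset M} (hS : S.card ≠ 0) :
    IsProbabilityMeasure (uniformMeasure S) := by
  constructor
  simp only [uniformMeasure, Measure.smul_apply, Measure.finsetSum_apply, smul_eq_mul,
    measure_univ, Finset.sum_const, nsmul_eq_mul, mul_one]
  exact ENNReal.inv_mul_cancel (by exact_mod_cast hS) (by simp)

theorem uniformMeasure_compl_eq_zero [MetricSpace M] {S : Finset M} {C : Set M}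
    (hC : MeasurableSet C) (hS : ∀ z ∈ S, z ∈ C) : uniformMeasure S Cᶜ = 0 := by
  simp only [uniformMeasure, Measure.smul_apply, Measure.finsetSum_apply, smul_eq_mul]
  rw [Finset.sum_eq_zero, mul_zero]
  intro z hz
  rw [Measure.dirac_apply' _ hC.compl, Set.indicator_of_notMem (by simpa using hS z hz)]

theorem integral_uniformMeasure [MetricSpace M] [BorelSpace M] (S : Finset M) (f : M → ℝ) :
    ∫ y, f y ∂(uniformMeasure S) = (S.card : ℝ)⁻¹ * ∑ z ∈ S, f z := by
  rw [uniformMeasure, integral_smul_measure, integral_finsetSum_measure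
    fun z _ => integrable_dirac (by simp)]
  simp

end UniformMeasure

/-! ### Mean distance and discrete energy -/

section MeanDistance

variable {M : Type*} [MetricSpace M]

theorem log_meanDistance {S : Finset M} :
    ∑ p ∈ S.offDiag, Real.log (dist p.1 p.2) =
      (S.card : ℝ) * ((S.card : ℝ) - 1) * Real.log (meanDistance S) := by
  classical
  have hpos : ∀ p ∈ S.offDiag, 0 < dist p.1 p.2 := fun p hp =>
    dist_pos.2 (Finset.mem_offDiag.1 hp).2.2
  rw [meanDistance, Real.log_prod (fun p hp => (Real.rpow_pos_of_pos (hpos p (by convert hp)) _).ne')]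
  rw [Finset.mul_sum]
  refine Finset.sum_congr (by congr) fun p hp => ?_
  have hp' := hpos p (by convert hp)
  rw [Real.log_rpow hp', ← mul_assoc]
  have hcard : 2 ≤ S.card := by
    have := Finset.mem_offDiag.1 hp
    exact Finset.one_lt_card.2 ⟨p.1, this.1, p.2, this.2.1, this.2.2⟩
  have h2 : (2 : ℝ) ≤ S.card := by exact_mod_cast hcard
  rw [mul_one_div_cancel (mul_pos (by linarith) (by linarith)).ne', one_mul]

theorem meanDistance_pos (S : Finset M) : 0 < meanDistance S :=
  Finset.prod_pos fun _ hp => Real.rpow_pos_of_pos (dist_pos.2 (Finset.mem_offDiag.1 hp).2.2) _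

/-- Off the diagonal truncation only lowers the kernel; the diagonal contributes `-log r / N`. -/
theorem integral_truncLog_uniformMeasure_le [MeasurableSpace M] [BorelSpace M] {S : Finset M}
    (hS : S.card ≠ 0) {r : ℝ} (hr : 0 < r) :
    ∫ x, ∫ y, truncLog r x y ∂(uniformMeasure S) ∂(uniformMeasure S) ≤
      -((1 - (S.card : ℝ)⁻¹) * Real.log (meanDistance S)) - (S.card : ℝ)⁻¹ * Real.log r := by
  classical
  have hN : (0 : ℝ) < S.card := by exact_mod_cast Nat.pos_of_ne_zero hS
  simp only [integral_uniformMeasure]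
  have hsum : ∑ x ∈ S, ∑ y ∈ S, truncLog r x y ≤
      -((S.card : ℝ) * ((S.card : ℝ) - 1) * Real.log (meanDistance S)) - S.card * Real.log r := by
    rw [← log_meanDistance, ← Finset.sum_product', ← Finset.diag_union_offDiag,
      Finset.sum_union (Finset.disjoint_diag_offDiag S), Finset.sum_diag]
    have h1 : ∑ x ∈ S, truncLog r x x = -(S.card * Real.log r) := by
      simp [truncLog, hr.le]
    have h2 : ∑ p ∈ S.offDiag, truncLog r p.1 p.2 ≤ -∑ p ∈ S.offDiag, Real.log (dist p.1 p.2) := by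
      rw [← Finset.sum_neg_distrib]
      refine Finset.sum_le_sum fun p hp => ?_
      exact neg_le_neg (Real.log_le_log (dist_pos.2 (Finset.mem_offDiag.1 hp).2.2) (le_max_left _ _))
    linarith
  rw [← Finset.mul_sum, ← mul_assoc]
  calc _ ≤ (S.card : ℝ)⁻¹ * (S.card : ℝ)⁻¹ *
        (-((S.card : ℝ) * ((S.card : ℝ) - 1) * Real.log (meanDistance S)) - S.card * Real.log r) := by
        gcongr
    _ = _ := by field_simp

theorem prod_offDiag_eq_meanDistance {n : ℕ} {x : Fin n → M} (hx : Function.Injective x)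
    {S : Finset M} (hS : S = Finset.univ.map ⟨x, hx⟩) :
    ∏ p ∈ (Finset.univ : Finset (Fin n)).offDiag,
      dist (x p.1) (x p.2) ^ (1 / ((n : ℝ) * ((n : ℝ) - 1))) = meanDistance S := by
  have hcard : S.card = n := by rw [hS]; simp
  rw [meanDistance, hcard]
  refine Finset.prod_bij (fun p _ => (x p.1, x p.2)) ?_ ?_ ?_ ?_
  · intro p hp
    rw [Finset.mem_offDiag] at hp ⊢
    subst hS
    simpa using fun h => hp.2.2 (hx h)
  · intro p _ q _ h
    simp only [Prod.mk.injEq] at h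
    exact Prod.ext (hx h.1) (hx h.2)
  · rintro ⟨a, b⟩ hp
    rw [Finset.mem_offDiag] at hp
    subst hS
    simp only [Finset.mem_map, Finset.mem_univ, true_and, Function.Embedding.coeFn_mk] at hp
    obtain ⟨⟨i, rfl⟩, ⟨j, rfl⟩, hij⟩ := hp
    exact ⟨(i, j), by simpa using fun h => hij (by rw [h]), rfl⟩
  · intro p _
    rfl

end MeanDistance

/-- `μ` is a probability measure on `F` whose potential is `V` on `F`, and is bounded below
by `V - h` everywhere, uniformly under truncation. -/
structure HasEquilibriumPotential {M : Type*} [MetricSpace M] [MeasurableSpace M] (F : Set M)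
    (h : M → ℝ) (V : ℝ) (μ : Measure M) : Prop where
  isProbabilityMeasure : IsProbabilityMeasure μ
  compl_eq_zero : μ Fᶜ = 0
  le_potential : ∀ ε > 0, ∃ r₀ > 0, ∀ r, 0 < r → r ≤ r₀ → ∀ x, V - h x - ε ≤ ∫ y, truncLog r x y ∂μ
  potential_le : ∀ x r, 0 < r → ∫ y, truncLog r x y ∂μ ≤ V

/-! ### Equilibrium measures from equilibrium potentials -/

section Equilibrium

variable {M : Type*} [MetricSpace M] [MeasurableSpace M] [BorelSpace M]
  {F : Set M} {h : M → ℝ} {V : ℝ} {μ : Measure M}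

/-- The lower bound on the potential holds off `F` too, at the price of `h`; this is where tautness
will enter. -/
theorem HasEquilibriumPotential.le_integral_uniformMeasure (H : HasEquilibriumPotential F h V μ)
    {ε : ℝ} (hε : 0 < ε) : ∃ r₀ > 0, ∀ r, 0 < r → r ≤ r₀ → ∀ S : Finset M, S.card ≠ 0 →
      V - (1 / (S.card : ℝ)) * ∑ z ∈ S, h z - ε ≤
        ∫ x, ∫ y, truncLog r x y ∂μ ∂(uniformMeasure S) := by
  obtain ⟨r₀, hr₀, hlow⟩ := H.le_potential ε hε
  refine ⟨r₀, hr₀, fun r hr hr' S hS => ?_⟩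
  have hN : (0 : ℝ) < S.card := by exact_mod_cast Nat.pos_of_ne_zero hS
  rw [integral_uniformMeasure]
  have := Finset.sum_le_sum fun x (_ : x ∈ S) => hlow r hr hr' x
  rw [Finset.sum_sub_distrib, Finset.sum_sub_distrib, Finset.sum_const, Finset.sum_const,
    nsmul_eq_mul, nsmul_eq_mul] at this
  calc _ = (S.card : ℝ)⁻¹ * (S.card * V - ∑ z ∈ S, h z - S.card * ε) := by field_simp
    _ ≤ _ := by gcongr

/-- Given points of `F`, there is another point of `F` far from all of them on average. -/
theorem HasEquilibriumPotential.exists_prod_dist_ge (H : HasEquilibriumPotential F h V μ)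
    (hF : IsCompact F) (S : Finset M) :
    ∃ y ∈ F, Real.exp (-(S.card * V)) ≤ ∏ z ∈ S, dist z y := by
  have := H.isProbabilityMeasure
  -- The `μ`-average over `y` of the sum of the truncated kernels is at most `N V`, so some `y ∈ F`
  -- does no worse. Compactness of `F` then removes the truncation.
  have hstep : ∀ m : ℕ, ∃ y ∈ F, Real.exp (-(S.card * V)) ≤
      ∏ z ∈ S, max (dist z y) (1 / ((m : ℝ) + 1)) := by
    intro m
    have hr : (0 : ℝ) < 1 / ((m : ℝ) + 1) := by positivity
    have hint : ∀ z, Integrable (fun y => truncLog (1 / ((m : ℝ) + 1)) z y) μ := fun z =>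
      integrable_of_continuous_of_compl_eq_zero hF H.compl_eq_zero (continuous_truncLog hr z)
    obtain ⟨y, hy, hle⟩ := exists_notMem_null_le_integral
      (integrable_finsetSum S fun z _ => hint z) H.compl_eq_zero
    refine ⟨y, not_not.1 hy, ?_⟩
    rw [integral_finsetSum _ fun z _ => hint z] at hle
    have h1 := hle.trans (Finset.sum_le_sum fun z _ => H.potential_le z _ hr)
    rw [Finset.sum_const, nsmul_eq_mul] at h1
    have hpos : ∀ z ∈ S, 0 < max (dist z y) (1 / ((m : ℝ) + 1)) := fun z _ => lt_max_of_lt_right hr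
    rw [← Real.le_log_iff_exp_le (Finset.prod_pos hpos), Real.log_prod fun z hz => (hpos z hz).ne']
    simp only [truncLog, Finset.sum_neg_distrib] at h1
    linarith
  choose y hyF hy using hstep
  obtain ⟨w, hwF, ψ, hψ, hlim⟩ := hF.tendsto_subseq hyF
  refine ⟨w, hwF, ?_⟩
  have ht : Tendsto (fun m => ∏ z ∈ S, max (dist z (y (ψ m))) (1 / ((ψ m : ℝ) + 1))) atTop
      (𝓝 (∏ z ∈ S, max (dist z w) 0)) := by
    refine tendsto_finsetProd _ fun z _ => ?_
    refine (tendsto_const_nhds.dist hlim).max ?_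
    exact tendsto_one_div_add_atTop_nhds_zero_nat.comp hψ.tendsto_atTop
  have := ge_of_tendsto' ht fun m => hy (ψ m)
  simpa only [max_eq_left dist_nonneg] using this

/-- Greedy choice: the point added to `n` others costs at most `2 n V` over ordered pairs, and `n (n
- 1) + 2 n = (n + 1) n`. -/
theorem HasEquilibriumPotential.exists_finset_neg_le_log_meanDistance
    (H : HasEquilibriumPotential F h V μ) (hF : IsCompact F) (n : ℕ) :
    ∃ S : Finset M, S.card = n ∧ (∀ z ∈ S, z ∈ F) ∧
      -(n * (n - 1) * V) ≤ ∑ p ∈ S.offDiag, Real.log (dist p.1 p.2) := by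
  classical
  induction n with
  | zero => exact ⟨∅, rfl, by simp, by simp⟩
  | succ n ih =>
    obtain ⟨S, hcard, hSF, hS⟩ := ih
    obtain ⟨y, hyF, hy⟩ := H.exists_prod_dist_ge hF S
    have hyS : y ∉ S := by
      intro hyS
      rw [Finset.prod_eq_zero (f := fun z => dist z y) hyS (dist_self y)] at hy
      exact absurd hy (not_le.2 (Real.exp_pos _))
    have hpos : 0 < ∏ z ∈ S, dist z y := (Real.exp_pos _).trans_le hy
    rw [← Real.le_log_iff_exp_le hpos,
      Real.log_prod fun z hz => (Finset.prod_ne_zero_iff.1 hpos.ne' z hz), hcard] at hy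
    refine ⟨insert y S, by rw [Finset.card_insert_of_notMem hyS, hcard], ?_, ?_⟩
    · intro z hz
      rcases Finset.mem_insert.1 hz with rfl | hz
      · exact hyF
      · exact hSF z hz
    · rw [Finset.offDiag_insert hyS, Finset.sum_union, Finset.sum_union, Finset.sum_product,
        Finset.sum_product, Finset.sum_singleton]
      · simp only [Finset.sum_singleton]
        have : ∑ z ∈ S, Real.log (dist y z) = ∑ z ∈ S, Real.log (dist z y) := by
          simp only [dist_comm]
        rw [this]
        push_cast
        nlinarith
      · rw [Finset.disjoint_left]
        rintro ⟨a, b⟩ h1 h2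
        simp only [Finset.mem_offDiag, Finset.mem_product, Finset.mem_singleton] at h1 h2
        exact hyS (h2.1 ▸ h1.1)
      · rw [Finset.disjoint_left]
        rintro ⟨a, b⟩ h1 h2
        simp only [Finset.mem_union, Finset.mem_offDiag, Finset.mem_product,
          Finset.mem_singleton] at h1 h2
        rcases h1 with h1 | h1
        · exact hyS (h2.2 ▸ h1.2.1)
        · exact hyS (h1.1 ▸ h2.1)

variable [IsUltrametricDist M]

theorem HasEquilibriumPotential.sq_sub_le (H : HasEquilibriumPotential F h V μ)
    {C : Set M} (hC : IsCompact C) (hFC : F ⊆ C) {ν : Measure M} [IsProbabilityMeasure ν]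
    (hν : ν Cᶜ = 0) {r r₀ r₁ : ℝ} (hr : 0 < r) (h₀ : r ≤ r₀) (h₁ : r₀ ≤ r₁) (x : M) {E : ℝ}
    (hE : E ≤ ∫ x, ∫ y, truncLog r x y ∂μ ∂ν) :
    (∫ y, (truncLog r₀ x y - truncLog r₁ x y) ∂ν - ∫ y, (truncLog r₀ x y - truncLog r₁ x y) ∂μ) ^ 2
      ≤ (Real.log r₁ - Real.log r₀) * (∫ x, ∫ y, truncLog r x y ∂ν ∂ν - 2 * E + V) := by
  have := H.isProbabilityMeasure
  have hμC : μ Cᶜ = 0 := measure_mono_null (Set.compl_subset_compl.2 hFC) H.compl_eq_zero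
  refine (sq_integral_truncLog_sub_le hC hμC hν hr h₀ h₁ x).trans ?_
  have hV : ∫ x, ∫ y, truncLog r x y ∂μ ∂μ ≤ V := by
    have hint : Integrable (fun x => ∫ y, truncLog r x y ∂μ) μ :=
      integrable_of_continuous_of_compl_eq_zero hC hμC
        (continuous_of_locally_const hr fun y z h => by simp only [truncLog_congr_left h])
    refine (integral_mono hint (integrable_const V) fun x => H.potential_le x r hr).trans_eq ?_
    simp
  refine mul_le_mul_of_nonneg_left (by linarith)
    (sub_nonneg.2 (Real.log_le_log (hr.trans_le h₀) h₁))

theorem HasEquilibriumPotential.le_integral_of_compl_eq_zero (H : HasEquilibriumPotential F h V μ)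
    (hF : IsCompact F) (hh : ∀ x ∈ F, h x = 0) {ε : ℝ} (hε : 0 < ε) : ∃ r₀ > 0, ∀ r, 0 < r →
      r ≤ r₀ → ∀ ν : Measure M, IsProbabilityMeasure ν → ν Fᶜ = 0 →
      V - ε ≤ ∫ x, ∫ y, truncLog r x y ∂μ ∂ν := by
  obtain ⟨r₀, hr₀, hlow⟩ := H.le_potential ε hε
  refine ⟨r₀, hr₀, fun r hr hr' ν _ hν => ?_⟩
  have hint : Integrable (fun x => ∫ y, truncLog r x y ∂μ) ν :=
    integrable_of_continuous_of_compl_eq_zero hF hν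
      (continuous_of_locally_const hr fun y z h => by simp only [truncLog_congr_left h])
  have hae : ∀ᵐ y ∂ν, y ∈ F := by rwa [ae_iff]
  have := integral_mono_ae (integrable_const (V - ε)) hint (hae.mono fun x hx => by
    have := hlow r hr hr' x
    rwa [hh x hx, sub_zero] at this)
  simpa using this

theorem HasEquilibriumPotential.le_energy (H : HasEquilibriumPotential F h V μ)
    (hF : IsCompact F) (hh : ∀ x ∈ F, h x = 0) {ν : Measure M} [IsProbabilityMeasure ν]
    (hν : ν Fᶜ = 0) {ε : ℝ} (hε : 0 < ε) : ∃ r₀ > 0, ∀ r, 0 < r → r ≤ r₀ →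
      V - 2 * ε ≤ ∫ x, ∫ y, truncLog r x y ∂ν ∂ν := by
  obtain ⟨r₀, hr₀, hlow⟩ := H.le_integral_of_compl_eq_zero hF hh hε
  refine ⟨r₀, hr₀, fun r hr hr' => ?_⟩
  obtain ⟨x⟩ : Nonempty M := nonempty_of_isProbabilityMeasure ν
  -- Only the nonnegativity of the right side matters, so any radius above `r` would serve in place
  -- of `2 * r`.
  have := H.sq_sub_le hF subset_rfl hν hr le_rfl (by linarith : r ≤ 2 * r) x
    (hlow r hr hr' ν ‹_› hν)
  have hL : 0 < Real.log (2 * r) - Real.log r :=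
    sub_pos.2 (Real.log_lt_log hr (by linarith))
  have := nonneg_of_mul_nonneg_right ((sq_nonneg _).trans this) hL
  linarith

theorem HasEquilibriumPotential.energy_le (H : HasEquilibriumPotential F h V μ)
    (hF : IsCompact F) : energy μ ≤ V := by
  have := H.isProbabilityMeasure
  refine energy_le_of_integral_integral_truncLog_le hF H.compl_eq_zero fun r hr => ?_
  have hint : Integrable (fun x => ∫ y, truncLog r x y ∂μ) μ :=
    integrable_of_continuous_of_compl_eq_zero hF H.compl_eq_zero
      (continuous_of_locally_const hr fun y z h => by simp only [truncLog_congr_left h])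
  refine (integral_mono hint (integrable_const V) fun x => H.potential_le x r hr).trans_eq ?_
  simp

theorem HasEquilibriumPotential.isEquilibriumMeasure (H : HasEquilibriumPotential F h V μ)
    (hF : IsCompact F) (hh : ∀ x ∈ F, h x = 0) : IsEquilibriumMeasure F μ := by
  refine ⟨H.isProbabilityMeasure, H.compl_eq_zero, fun ν _ hν => (H.energy_le hF).trans ?_⟩
  by_contra hlt
  obtain ⟨q, hq1, hq2⟩ := EReal.lt_iff_exists_real_btwn.1 (not_le.1 hlt)
  have hqV : q < V := EReal.coe_lt_coe_iff.1 hq2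
  obtain ⟨r₀, hr₀, hlow⟩ := H.le_energy hF hh hν (half_pos (sub_pos.2 hqV))
  have h1 := hlow (min r₀ 1) (lt_min hr₀ one_pos) (min_le_left _ _)
  have h2 := integral_integral_truncLog_le_energy hF hν (lt_min hr₀ one_pos) (min_le_right r₀ 1)
  have h3 : (q : EReal) ≤ energy ν :=
    (EReal.coe_le_coe_iff.2 (by linarith : q ≤ _)).trans h2
  exact absurd h3 (not_le.2 hq1)

/-- Minimal energy forces the energy of `ν - μ` to vanish, so all test integrals agree; the constant
sequence `ν` then converges weakly to `μ`, and limits are unique. -/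
theorem HasEquilibriumPotential.eq_of_isEquilibriumMeasure (H : HasEquilibriumPotential F h V μ)
    (hF : IsCompact F) (hh : ∀ x ∈ F, h x = 0) {ν : Measure M} (hν : IsEquilibriumMeasure F ν) :
    ν = μ := by
  have := H.isProbabilityMeasure
  have := hν.isProbabilityMeasure
  have hen : energy ν ≤ V := (hν.energy_le μ ‹_› H.compl_eq_zero).trans (H.energy_le hF)
  have hEq : ∀ x r₀ r₁, 0 < r₀ → r₀ < r₁ → ∫ y, (truncLog r₀ x y - truncLog r₁ x y) ∂ν =
      ∫ y, (truncLog r₀ x y - truncLog r₁ x y) ∂μ := by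
    intro x r₀ r₁ h₀ h₁
    have hL : 0 < Real.log r₁ - Real.log r₀ := sub_pos.2 (Real.log_lt_log h₀ h₁)
    rw [← sub_eq_zero, ← sq_eq_zero_iff]
    refine le_antisymm (le_of_forall_pos_le_add fun ε hε => ?_) (sq_nonneg _)
    obtain ⟨r, hr, hlow⟩ := H.le_integral_of_compl_eq_zero hF hh
      (ε := ε / (2 * (Real.log r₁ - Real.log r₀))) (by positivity)
    have hs : 0 < min r (min 1 r₀) := lt_min hr (lt_min one_pos h₀)
    have h2 := H.sq_sub_le hF subset_rfl hν.supported hs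
      ((min_le_right _ _).trans (min_le_right _ _)) h₁.le x
      (hlow _ hs (min_le_left _ _) ν ‹_› hν.supported)
    have h3 := (integral_integral_truncLog_le_energy hF hν.supported hs
      ((min_le_right _ _).trans (min_le_left _ _))).trans hen
    rw [EReal.coe_le_coe_iff] at h3
    refine h2.trans ?_
    calc _ ≤ (Real.log r₁ - Real.log r₀) * (V - 2 * (V - ε / (2 * (Real.log r₁ - Real.log r₀))) + V) := by
          gcongr
      _ = 0 + ε := by field_simp; ring
  have hlim := tendsto_probabilityMeasure_of_truncLog (ν := fun _ => ν) hF H.compl_eq_zero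
    fun x r₀ r₁ h₀ h₁ => by simp only [hEq x r₀ r₁ h₀ h₁]; exact tendsto_const_nhds
  exact congrArg (fun ρ : ProbabilityMeasure M => (ρ : Measure M))
    (tendsto_nhds_unique tendsto_const_nhds hlim)

/-- Upper bound for the mean distance of finite subsets of `F`. -/
theorem HasEquilibriumPotential.exists_log_meanDistance_le (H : HasEquilibriumPotential F h V μ)
    (hF : IsCompact F) (hh : ∀ x ∈ F, h x = 0) {ε : ℝ} (hε : 0 < ε) : ∃ A : ℝ, ∀ S : Finset M,
      2 ≤ S.card → (∀ z ∈ S, z ∈ F) →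
      (1 - (S.card : ℝ)⁻¹) * Real.log (meanDistance S) ≤ -V + ε + A * (S.card : ℝ)⁻¹ := by
  obtain ⟨r, hr, hlow⟩ := H.le_integral_of_compl_eq_zero hF hh (half_pos hε)
  refine ⟨-Real.log r, fun S hS hSF => ?_⟩
  have hS0 : S.card ≠ 0 := by omega
  have := isProbabilityMeasure_uniformMeasure hS0
  have hν := uniformMeasure_compl_eq_zero hF.measurableSet hSF
  obtain ⟨x⟩ : Nonempty M := nonempty_of_isProbabilityMeasure (uniformMeasure S)
  have h1 := H.sq_sub_le hF subset_rfl hν hr le_rfl (by linarith : r ≤ 2 * r) x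
    (hlow r hr le_rfl _ ‹_› hν)
  have hL : 0 < Real.log (2 * r) - Real.log r :=
    sub_pos.2 (Real.log_lt_log hr (by linarith))
  have h2 := nonneg_of_mul_nonneg_right ((sq_nonneg _).trans h1) hL
  have h3 := integral_truncLog_uniformMeasure_le hS0 hr
  linarith

end Equilibrium

/-! ### The transfinite diameter equals `exp (-V)`; equidistribution -/

section TransfiniteDiameter

variable {M : Type*} [MetricSpace M] [MeasurableSpace M] [BorelSpace M] [IsUltrametricDist M]
  {F : Set M} {h : M → ℝ} {V : ℝ} {μ : Measure M}

theorem HasEquilibriumPotential.exists_prod_offDiag_le (H : HasEquilibriumPotential F h V μ)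
    (hF : IsCompact F) (hh : ∀ x ∈ F, h x = 0) {ε : ℝ} (hε : 0 < ε) : ∃ A : ℝ, ∀ n : ℕ, 2 ≤ n →
      ∀ x : Fin n → F, ∏ p ∈ (Finset.univ : Finset (Fin n)).offDiag,
        dist (x p.1 : M) (x p.2 : M) ^ (1 / ((n : ℝ) * ((n : ℝ) - 1))) ≤
        Real.exp ((-V + ε + A * (n : ℝ)⁻¹) / (1 - (n : ℝ)⁻¹)) := by
  obtain ⟨A, hA⟩ := H.exists_log_meanDistance_le hF hh hε
  refine ⟨A, fun n hn x => ?_⟩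
  have hn2 : (2 : ℝ) ≤ n := by exact_mod_cast hn
  by_cases hx : Function.Injective fun i => (x i : M)
  · set S : Finset M := Finset.univ.map ⟨_, hx⟩ with hS
    have hcard : S.card = n := by rw [hS]; simp
    have hSF : ∀ z ∈ S, z ∈ F := by
      intro z hz
      obtain ⟨i, -, rfl⟩ := Finset.mem_map.1 hz
      exact (x i).2
    have h1 := hA S (by omega) hSF
    rw [hcard] at h1
    rw [prod_offDiag_eq_meanDistance hx hS, ← Real.log_le_iff_le_exp (meanDistance_pos S),
      le_div_iff₀ (sub_pos.2 (inv_lt_one_of_one_lt₀ (by linarith))), mul_comm]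
    exact h1
  -- A repeated point gives a factor `0`, the exponent being nonzero for `n ≥ 2`.
  · simp only [Function.Injective] at hx
    push Not at hx
    obtain ⟨i, j, hij, hne⟩ := hx
    rw [Finset.prod_eq_zero (i := (i, j)) (by simpa using hne)]
    · positivity
    · have : (0 : ℝ) < (n : ℝ) * ((n : ℝ) - 1) := mul_pos (by linarith) (by linarith)
      rw [dist_eq_zero.2 hij, Real.zero_rpow (one_div_pos.2 this).ne']

theorem HasEquilibriumPotential.exp_neg_le_nthDiameter (H : HasEquilibriumPotential F h V μ)
    (hF : IsCompact F) (hh : ∀ x ∈ F, h x = 0) {n : ℕ} (hn : 2 ≤ n) :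
    Real.exp (-V) ≤ nthDiameter F n := by
  obtain ⟨A, hA⟩ := H.exists_prod_offDiag_le hF hh one_pos
  obtain ⟨S, hcard, hSF, hS⟩ := H.exists_finset_neg_le_log_meanDistance hF n
  have hn2 : (2 : ℝ) ≤ n := by exact_mod_cast hn
  set e := (S.equivFin.trans (finCongr hcard)).symm with he
  have hinj : Function.Injective fun i => (e i : M) :=
    Subtype.val_injective.comp e.injective
  have hSe : S = Finset.univ.map ⟨_, hinj⟩ := by
    ext z
    simp only [Finset.mem_map, Finset.mem_univ, true_and, Function.Embedding.coeFn_mk]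
    constructor
    · intro hz
      exact ⟨e.symm ⟨z, hz⟩, by simp⟩
    · rintro ⟨i, rfl⟩
      exact (e i).2
  have hle := le_ciSup (f := fun x : Fin n → F => ∏ p ∈ (Finset.univ : Finset (Fin n)).offDiag,
    dist (x p.1 : M) (x p.2 : M) ^ (1 / ((n : ℝ) * ((n : ℝ) - 1))))
    ⟨_, Set.forall_mem_range.2 fun x => hA n hn x⟩ (fun i => ⟨e i, hSF _ (e i).2⟩)
  refine le_trans ?_ hle
  simp only
  rw [prod_offDiag_eq_meanDistance hinj hSe, ← Real.le_log_iff_exp_le (meanDistance_pos S)]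
  rw [log_meanDistance, hcard] at hS
  have hpos : (0 : ℝ) < (n : ℝ) * ((n : ℝ) - 1) := mul_pos (by linarith) (by linarith)
  rw [← mul_neg] at hS
  exact le_of_mul_le_mul_left hS hpos

theorem HasEquilibriumPotential.transfiniteDiameter_eq (H : HasEquilibriumPotential F h V μ)
    (hF : IsCompact F) (hh : ∀ x ∈ F, h x = 0) : transfiniteDiameter F = Real.exp (-V) := by
  refine Tendsto.limUnder_eq (tendsto_order.2 ⟨fun a ha => ?_, fun a ha => ?_⟩)
  · filter_upwards [eventually_ge_atTop 2] with n hn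
    exact ha.trans_le (H.exp_neg_le_nthDiameter hF hh hn)
  · have ha0 : 0 < a := (Real.exp_pos _).trans ha
    have hlog : -V < Real.log a := (Real.lt_log_iff_exp_lt ha0).2 ha
    obtain ⟨A, hA⟩ := H.exists_prod_offDiag_le hF hh (half_pos (sub_pos.2 hlog))
    have hinv : Tendsto (fun n : ℕ => (n : ℝ)⁻¹) atTop (𝓝 0) := tendsto_inv_atTop_nhds_zero_nat
    have hlim : Tendsto (fun n : ℕ => (-V + (Real.log a - -V) / 2 + A * (n : ℝ)⁻¹) / (1 - (n : ℝ)⁻¹))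
        atTop (𝓝 ((-V + (Real.log a - -V) / 2 + A * 0) / (1 - 0))) :=
      ((hinv.const_mul A).const_add _).div (hinv.const_sub 1) (by norm_num)
    filter_upwards [eventually_ge_atTop 2, hlim.eventually_lt_const
      (show _ < Real.log a by linarith)] with n hn hlt
    refine lt_of_le_of_lt (Real.iSup_le (hA n hn) (Real.exp_pos _).le) ?_
    rwa [← Real.lt_log_iff_exp_lt ha0]

theorem HasEquilibriumPotential.isEquidistributed (H : HasEquilibriumPotential F h V μ)
    (hF : IsCompact F) (hh : ∀ x ∈ F, h x = 0) {S : ℕ → Finset M}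
    (hS : IsPseudoEquidistributed F h S) : IsEquidistributed S μ := by
  classical
  obtain ⟨htaut, hcard, hmean⟩ := hS
  rw [H.transfiniteDiameter_eq hF hh] at hmean
  have hμ := H.isProbabilityMeasure
  -- Empty sets, which occur only for finitely many `n`, are given `μ` so that every term is a
  -- probability measure.
  set ν : ℕ → Measure M := fun n => if (S n).card = 0 then μ else uniformMeasure (S n) with hν
  have hνp : ∀ n, IsProbabilityMeasure (ν n) := by
    intro n
    simp only [hν]
    split_ifs with h0
    · exact hμ
    · exact isProbabilityMeasure_uniformMeasure h0
  have hνeq : ∀ᶠ n in atTop, ν n = uniformMeasure (S n) := by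
    filter_upwards [hcard.eventually_ge_atTop 1] with n hn
    simp only [hν]
    rw [if_neg (by omega)]
  have hlogm : Tendsto (fun n => Real.log (meanDistance (S n))) atTop (𝓝 (-V)) := by
    have := hmean.log (Real.exp_pos _).ne'
    rwa [Real.log_exp] at this
  have hinv : Tendsto (fun n => ((S n).card : ℝ)⁻¹) atTop (𝓝 0) :=
    tendsto_inv_atTop_nhds_zero_nat.comp hcard
  have hkey : ∀ x r₀ r₁, 0 < r₀ → r₀ < r₁ → Tendsto
      (fun n => ∫ y, (truncLog r₀ x y - truncLog r₁ x y) ∂(ν n)) atTop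
      (𝓝 (∫ y, (truncLog r₀ x y - truncLog r₁ x y) ∂μ)) := by
    intro x r₀ r₁ h₀ h₁
    have hL : 0 < Real.log r₁ - Real.log r₀ := sub_pos.2 (Real.log_lt_log h₀ h₁)
    rw [Metric.tendsto_nhds]
    intro η hη
    obtain ⟨rε, hrε, hlow⟩ := H.le_integral_uniformMeasure
      (ε := η ^ 2 / (4 * (Real.log r₁ - Real.log r₀))) (by positivity)
    set r := min rε r₀
    have hr : 0 < r := lt_min hrε h₀
    -- Chosen so that the limiting bound `2 ε log (r₁ / r₀)` equals `η ^ 2 / 2`.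
    set ε := η ^ 2 / (4 * (Real.log r₁ - Real.log r₀)) with hε
    have hlim : Tendsto (fun n => (Real.log r₁ - Real.log r₀) *
        (-((1 - ((S n).card : ℝ)⁻¹) * Real.log (meanDistance (S n))) -
          ((S n).card : ℝ)⁻¹ * Real.log r -
          2 * (V - (1 / ((S n).card : ℝ)) * ∑ z ∈ S n, h z - ε) + V)) atTop
        (𝓝 ((Real.log r₁ - Real.log r₀) *
          (-((1 - 0) * (-V)) - 0 * Real.log r - 2 * (V - 0 - ε) + V))) :=
      ((((((hinv.const_sub 1).mul hlogm).neg.sub (hinv.mul_const _)).sub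
        (((htaut.const_sub V).sub_const ε).const_mul 2)).add_const V).const_mul _)
    have hlt : (Real.log r₁ - Real.log r₀) *
          (-((1 - 0) * (-V)) - 0 * Real.log r - 2 * (V - 0 - ε) + V) < η ^ 2 := by
      have : (Real.log r₁ - Real.log r₀) *
          (-((1 - 0) * (-V)) - 0 * Real.log r - 2 * (V - 0 - ε) + V) = η ^ 2 / 2 := by
        rw [hε]; field_simp; ring
      rw [this]
      exact half_lt_self (by positivity)
    filter_upwards [hνeq, hcard.eventually_ge_atTop 1, hlim.eventually_lt_const hlt]
      with n hn hn1 hn2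
    have hS0 : (S n).card ≠ 0 := by omega
    have := isProbabilityMeasure_uniformMeasure hS0
    -- The points of `S n` need not lie in `F`; the compact carrier may depend on `n`, as the
    -- inequality does not involve it.
    have hC : IsCompact (F ∪ (S n : Set M)) := hF.union (S n).finite_toSet.isCompact
    have hsq := H.sq_sub_le hC Set.subset_union_left
      (uniformMeasure_compl_eq_zero hC.measurableSet fun z hz => Or.inr hz) hr (min_le_right _ _)
      h₁.le x (hlow r hr (min_le_left _ _) (S n) hS0)
    have hI := integral_truncLog_uniformMeasure_le hS0 hr
    have hlt2 : (∫ y, (truncLog r₀ x y - truncLog r₁ x y) ∂(uniformMeasure (S n)) -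
        ∫ y, (truncLog r₀ x y - truncLog r₁ x y) ∂μ) ^ 2 < η ^ 2 := by
      refine (hsq.trans (mul_le_mul_of_nonneg_left ?_ hL.le)).trans_lt hn2
      linarith
    rw [hn, Real.dist_eq]
    exact abs_lt_of_sq_lt_sq hlt2 hη.le
  have hconv := tendsto_probabilityMeasure_of_truncLog hF H.compl_eq_zero hkey
  intro f
  have hf := (ProbabilityMeasure.tendsto_iff_forall_integral_tendsto.1 hconv) f
  refine hf.congr' ?_
  filter_upwards [hνeq] with n hn
  simp only [ProbabilityMeasure.coe_mk, hn]

end TransfiniteDiameter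

end NonarchEquidist

theorem mainTheorem5 {L : Type*} [NormedField L] [IsUltrametricDist L] [CompleteSpace L]
    [IsAlgClosed L] [MeasurableSpace L] [BorelSpace L]
    (φ : Polynomial L) (hdeg : 2 ≤ φ.natDegree)
    (hF : IsCompact (NonarchEquidist.filledJuliaSet φ)) :
    (∀ S : ℕ → Finset L,
      NonarchEquidist.IsTaut (NonarchEquidist.canonicalLocalHeight φ) S →
        NonarchEquidist.IsTight (NonarchEquidist.filledJuliaSet φ) S) ∧
    ∃ μ : Measure L,
      NonarchEquidist.IsEquilibriumMeasure (NonarchEquidist.filledJuliaSet φ) μ ∧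
      (∀ ν : Measure L,
        NonarchEquidist.IsEquilibriumMeasure (NonarchEquidist.filledJuliaSet φ) ν → ν = μ) ∧
      ∀ S : ℕ → Finset L,
        NonarchEquidist.IsPseudoEquidistributed (NonarchEquidist.filledJuliaSet φ)
            (NonarchEquidist.canonicalLocalHeight φ) S →
          NonarchEquidist.IsEquidistributed S μ := by
  obtain ⟨μ, V, hμ, hμF, hlow, hup⟩ :=
    NonarchEquidist.exists_measure_integral_truncLog hdeg hF
  have H : NonarchEquidist.HasEquilibriumPotential (NonarchEquidist.filledJuliaSet φ)
      (NonarchEquidist.canonicalLocalHeight φ) V μ := ⟨hμ, hμF, hlow, hup⟩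
  have hh : ∀ x ∈ NonarchEquidist.filledJuliaSet φ, NonarchEquidist.canonicalLocalHeight φ x = 0 :=
    fun x hx => (NonarchEquidist.mem_filledJuliaSet_iff hdeg x).1 hx
  exact ⟨fun S hS => NonarchEquidist.isTight_of_isTaut hdeg hF hS, μ,
    H.isEquilibriumMeasure hF hh, fun ν hν => H.eq_of_isEquilibriumMeasure hF hh hν,
    fun S hS => H.isEquidistributed hF hh hS⟩
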